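/- Let $R$ and $S$ be associative rings with unit, and let ${}_R\omega_S$ be a semidualizing bimodule; that is: ${}_R\omega$ and $\omega_S$ have resolutions by finitely generated projective modules (over $R$ and over $S^{op}$, respectively), the homothety maps $R\to\mathrm{Hom}_{S^{op}}(\omega,\omega)$ and $S\to\mathrm{Hom}_R(\omega,\omega)$ are bijective, and $\mathrm{Ext}_R^{i}(\omega,\omega)=0=\mathrm{Ext}_{S^{op}}^{i}(\omega,\omega)$ for all $i\geq 1$. The Bass class $\mathcal{B}_\omega(R)$ consists of the left $R$-modules $M$ such that $\mathrm{Ext}^i_R(\omega,M)=0$ and $\mathrm{Tor}_i^S(\omega,\mathrm{Hom}_R(\omega,M))=0$ for all $i\geq 1$, and such that the evaluation map $\omega\otimes_S\mathrm{Hom}_R(\omega,M)\to M$ is an isomorphism. Let $\mathbf{D}^b(R)$ be the full subcategory of the derived category of left $R$-modules given by the complexes whose cohomology is nonzero in only finitely many degrees. The Bass class $\mathcal{B}^\bullet_\omega(R)$ of complexes is the full subcategory of $\mathbf{D}^b(R)$ given by those $M^\bullet$ for which $\mathbf{R}\mathrm{Hom}_R(\omega,M^\bullet)\in\mathbf{D}^b(S)$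 and the canonical morphism $\omega\otimes^{\mathbf{L}}_S\mathbf{R}\mathrm{Hom}_R(\omega,M^\bullet)\to M^\bullet$ is an isomorphism. The Bass injective dimension of $M^\bullet\in\mathbf{D}^b(R)$ is $$\mathcal{B}^\bullet_\omega(R)\text{-}\mathrm{id}\,M^\bullet=\begin{cases}\sup\{n\in\mathbb{Z}\mid H^n(\mathbf{R}\mathrm{Hom}_R(\omega,M^\bullet))\neq 0\}&\text{if }M^\bullet\in\mathcal{B}^\bullet_\omega(R),\\+\infty&\text{otherwise,}\end{cases}$$ where $\sup\emptyset=-\infty$. Theorem. For every $M^\bullet\in\mathbf{D}^b(R)$ the following are equivalent: (1) $\mathcal{B}^\bullet_\omega(R)\text{-}\mathrm{id}\,M^\bullet<\infty$; (2) there is an isomorphism $M^\bullet\to Y^\bullet$ in $\mathbf{D}^b(R)$, where $Y^\bullet$ is a bounded complex of modules in $\mathcal{B}_\omega(R)$. -/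

import Mathlib

open CategoryTheory
open scoped TensorProduct

universe w w' u

namespace BassClass

section Modules

/-- The abelian group `Hom_R(ω, M)`, for an `(R, S)`-bimodule `ω` and a left `R`-module `M`.
The ring `S` is recorded because this group is regarded as a left `S`-module. -/
def HomMod (R _S ω M : Type u) [Ring R] [AddCommGroup ω] [Module R ω]
    [AddCommGroup M] [Module R M] : Type u := ω →ₗ[R] M

/-- The kernel of `ω ⊗_ℤ N → ω ⊗_S N`: it is generated by the elements `xs ⊗ n - x ⊗ sn`.
(This set of generators is stable under `R`, so its `R`-span is its additive span.) -/
def tensorRel (R S ω N : Type u) [Ring R] [Ring S] [AddCommGroup ω] [Module R ω]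
    [Module Sᵐᵒᵖ ω] [AddCommGroup N] [Module S N] : Submodule R (ω ⊗[ℤ] N) :=
  Submodule.span R {z | ∃ (x : ω) (s : S) (n : N),
    z = (MulOpposite.op s • x) ⊗ₜ[ℤ] n - x ⊗ₜ[ℤ] (s • n)}

/-- The left `R`-module `ω ⊗_S N`, for an `(R, S)`-bimodule `ω` and a left `S`-module `N`. -/
abbrev TensorMod (R S ω N : Type u) [Ring R] [Ring S] [AddCommGroup ω] [Module R ω]
    [Module Sᵐᵒᵖ ω] [AddCommGroup N] [Module S N] : Type u :=
  (ω ⊗[ℤ] N) ⧸ tensorRel R S ω N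

variable {R S : Type u} [Ring R] [Ring S]
variable (ω : Type u) [AddCommGroup ω] [Module R ω] [Module Sᵐᵒᵖ ω] [SMulCommClass R Sᵐᵒᵖ ω]

variable (R S) in
/-- The homothety map `R → Hom_{S^op}(ω, ω)`, `r ↦ (x ↦ rx)`. -/
def leftHomothety (r : R) : ω →ₗ[Sᵐᵒᵖ] ω where
  toFun x := r • x
  map_add' := smul_add r
  map_smul' s x := smul_comm r s x

variable (R S) in
/-- The homothety map `S → Hom_R(ω, ω)`, `s ↦ (x ↦ xs)`. -/
def rightHomothety (s : S) : ω →ₗ[R] ω where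
  toFun x := MulOpposite.op s • x
  map_add' := smul_add _
  map_smul' r x := (smul_comm r (MulOpposite.op s) x).symm

namespace HomMod
variable {M : Type u} [AddCommGroup M] [Module R M]

noncomputable instance : AddCommGroup (HomMod R S ω M) :=
  inferInstanceAs (AddCommGroup (ω →ₗ[R] M))

/-- An element of `Hom_R(ω, M)`, as an `R`-linear map. -/
def toLin (f : HomMod R S ω M) : ω →ₗ[R] M := f

/-- The left `S`-module structure `(s • f)(x) = f(xs)` on `Hom_R(ω, M)`. -/
noncomputable instance : Module S (HomMod R S ω M) where
  smul s f := (toLin ω f).comp (rightHomothety R S ω s)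
  one_smul f := LinearMap.ext fun x => congrArg (toLin ω f) (one_smul Sᵐᵒᵖ x)
  mul_smul s t f := LinearMap.ext fun x =>
    congrArg (toLin ω f) (mul_smul (MulOpposite.op t) (MulOpposite.op s) x)
  smul_zero _ := rfl
  smul_add _ _ _ := rfl
  add_smul s t f := LinearMap.ext fun x =>
    (congrArg (toLin ω f) (add_smul (MulOpposite.op s) (MulOpposite.op t) x)).trans
      (map_add _ _ _)
  zero_smul f := LinearMap.ext fun x =>
    (congrArg (toLin ω f) (zero_smul Sᵐᵒᵖ x)).trans (map_zero _)

theorem smul_apply (s : S) (f : HomMod R S ω M) (x : ω) :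
    toLin ω (s • f) x = toLin ω f (MulOpposite.op s • x) := rfl

variable {M' : Type u} [AddCommGroup M'] [Module R M']

/-- The map `Hom_R(ω, M) → Hom_R(ω, M')`, `f ↦ g ∘ f`. -/
noncomputable def map (g : M →ₗ[R] M') : HomMod R S ω M →ₗ[S] HomMod R S ω M' where
  toFun f := g.comp (toLin ω f)
  map_add' _ _ := LinearMap.ext fun _ => map_add g _ _
  map_smul' _ _ := rfl

end HomMod

variable (R S)

/-- The functor `(-)_* = Hom_R(ω, -)` from left `R`-modules to left `S`-modules. -/
noncomputable def homFunctor : ModuleCat.{u} R ⥤ ModuleCat.{u} S where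
  obj M := ModuleCat.of S (HomMod R S ω M)
  map g := ModuleCat.ofHom (HomMod.map ω g.hom)
  map_id _ := rfl
  map_comp _ _ := rfl

instance : (homFunctor R S ω).Additive where
  map_add := rfl

variable {R S}

namespace TensorMod

variable {N : Type u} [AddCommGroup N] [Module S N]
variable {N' : Type u} [AddCommGroup N'] [Module S N']

/-- The map `ω ⊗_S N → ω ⊗_S N'`, `x ⊗ n ↦ x ⊗ g n`. -/
noncomputable def map (g : N →ₗ[S] N') : TensorMod R S ω N →ₗ[R] TensorMod R S ω N' :=
  Submodule.mapQ _ _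
    (TensorProduct.AlgebraTensorModule.map (LinearMap.id : ω →ₗ[R] ω) (g.restrictScalars ℤ)) (by
    rw [tensorRel, Submodule.span_le]
    rintro _ ⟨x, s, n, rfl⟩
    exact Submodule.subset_span ⟨x, s, g n, by simp⟩)

/-- The evaluation map `θ_M : ω ⊗_S Hom_R(ω, M) → M`, `x ⊗ f ↦ f x`. -/
noncomputable def eval (M : Type u) [AddCommGroup M] [Module R M] :
    TensorMod R S ω (HomMod R S ω M) →ₗ[R] M :=
  (tensorRel R S ω (HomMod R S ω M)).liftQ
    (TensorProduct.AlgebraTensorModule.lift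
      { toFun := fun x =>
          { toFun := fun f => HomMod.toLin ω f x
            map_add' := fun _ _ => rfl
            map_smul' := fun c f => LinearMap.smul_apply c (HomMod.toLin ω f) x }
        map_add' := fun x y => LinearMap.ext fun f => map_add (HomMod.toLin ω f) x y
        map_smul' := fun r x => LinearMap.ext fun f => map_smul (HomMod.toLin ω f) r x }) (by
    rw [tensorRel, Submodule.span_le]
    rintro _ ⟨x, s, f, rfl⟩
    exact (map_sub _ _ _).trans (sub_eq_zero.2 rfl))

end TensorMod

variable (R S)

/-- The functor `ω ⊗_S -` from left `S`-modules to left `R`-modules. -/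
noncomputable def tensorFunctor : ModuleCat.{u} S ⥤ ModuleCat.{u} R where
  obj N := ModuleCat.of R (TensorMod R S ω N)
  map g := ModuleCat.ofHom (TensorMod.map ω g.hom)
  map_id N := by
    ext : 1
    refine Submodule.linearMap_qext _ (TensorProduct.AlgebraTensorModule.ext fun x n => ?_)
    simp [TensorMod.map]
  map_comp g h := by
    ext : 1
    refine Submodule.linearMap_qext _ (TensorProduct.AlgebraTensorModule.ext fun x n => ?_)
    simp [TensorMod.map]

instance : (tensorFunctor R S ω).Additive where
  map_add {N N' g h} := by
    ext : 1
    refine Submodule.linearMap_qext _ (TensorProduct.AlgebraTensorModule.ext fun x n => ?_)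
    exact congrArg (tensorRel R S ω N').mkQ (TensorProduct.tmul_add x (g n) (h n))

/-- The evaluation maps `θ_M`, as a natural transformation. -/
noncomputable def evalNat : homFunctor R S ω ⋙ tensorFunctor R S ω ⟶ 𝟭 (ModuleCat.{u} R) where
  app M := ModuleCat.ofHom (TensorMod.eval ω M)
  naturality M M' g := by
    ext : 1
    exact Submodule.linearMap_qext _ (TensorProduct.AlgebraTensorModule.ext fun x f => rfl)

end Modules

section KProj
open Limits HomologicalComplex MorphismProperty ZeroObject

variable (S : Type u) [Ring S]

lemma up_rel (n : ℤ) : (ComplexShape.up ℤ).Rel n (n + 1) := rfl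

/-- The disk `S = S`, in degrees `n` and `n + 1`. -/
noncomputable def disk (n : ℤ) : CochainComplex (ModuleCat.{u} S) ℤ :=
  double (𝟙 (ModuleCat.of S S)) (up_rel n)

/-- The sphere `S`, in degree `n + 1`. -/
noncomputable def sphere (n : ℤ) : CochainComplex (ModuleCat.{u} S) ℤ :=
  (single _ (ComplexShape.up ℤ) (n + 1)).obj (ModuleCat.of S S)

/-- The degree `n` part of the disk. -/
noncomputable def diskIso₀ (n : ℤ) : (disk S n).X n ≅ ModuleCat.of S S :=
  doubleXIso₀ (𝟙 (ModuleCat.of S S)) (up_rel n)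

/-- The degree `n + 1` part of the disk. -/
noncomputable def diskIso₁ (n : ℤ) : (disk S n).X (n + 1) ≅ ModuleCat.of S S :=
  doubleXIso₁ (𝟙 (ModuleCat.of S S)) (up_rel n) (by lia)

/-- The degree `n + 1` part of the sphere. -/
noncomputable def sphereIso (n : ℤ) : (sphere S n).X (n + 1) ≅ ModuleCat.of S S :=
  singleObjXSelf (ComplexShape.up ℤ) (n + 1) (ModuleCat.of S S)

lemma disk_d (n : ℤ) : (disk S n).d n (n + 1) = (diskIso₀ S n).hom ≫ (diskIso₁ S n).inv :=
  (double_d (𝟙 (ModuleCat.of S S)) (up_rel n) (by lia)).trans (by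
    rw [Category.id_comp]; rfl)

variable {S}

/-- The morphism from the disk given by an element of degree `n`. -/
noncomputable def diskHom {K : CochainComplex (ModuleCat.{u} S) ℤ} (n : ℤ) (x : K.X n) :
    disk S n ⟶ K :=
  mkHomFromDouble (up_rel n) (by lia) (ModuleCat.ofHom (LinearMap.toSpanSingleton S _ x))
    (ModuleCat.ofHom (LinearMap.toSpanSingleton S _ x) ≫ K.d n (n + 1)) (by simp) (by simp)

/-- The morphism from the sphere given by a cocycle of degree `n + 1`. -/
noncomputable def sphereHom {K : CochainComplex (ModuleCat.{u} S) ℤ} (n : ℤ) (x : K.X (n + 1))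
    (hx : K.d (n + 1) (n + 1 + 1) x = 0) : sphere S n ⟶ K :=
  mkHomFromSingle (ModuleCat.ofHom (LinearMap.toSpanSingleton S _ x)) (by
    rintro _ rfl
    ext
    simpa using hx)

/-- The generator of the disk. -/
noncomputable def diskElt (n : ℤ) : (disk S n).X n := (diskIso₀ S n).inv (1 : S)

/-- The generator of the sphere. -/
noncomputable def sphereElt (n : ℤ) : (sphere S n).X (n + 1) := (sphereIso S n).inv (1 : S)

lemma diskHom_elt {K : CochainComplex (ModuleCat.{u} S) ℤ} (n : ℤ) (x : K.X n) :
    (diskHom n x).f n (diskElt n) = x := by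
  have h1 : (diskHom n x).f n = (diskIso₀ S n).hom ≫
      ModuleCat.ofHom (LinearMap.toSpanSingleton S _ x) := mkHomFromDouble_f₀ ..
  have h : (diskIso₀ S n).inv ≫ (diskHom n x).f n =
      ModuleCat.ofHom (LinearMap.toSpanSingleton S _ x) := by
    rw [h1, Iso.inv_hom_id_assoc]
  exact (ConcreteCategory.congr_hom h (1 : S)).trans (one_smul S x)

lemma disk_hom_ext {K : CochainComplex (ModuleCat.{u} S) ℤ} {n : ℤ} {f g : disk S n ⟶ K}
    (h : f.f n (diskElt n) = g.f n (diskElt n)) : f = g := by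
  apply (evalCompCoyonedaCorepresentableByDoubleId (C := ModuleCat.{u} S)
    (up_rel n) (by lia) (ModuleCat.of S S)).homEquiv.injective
  apply ModuleCat.hom_ext
  apply LinearMap.ext_ring
  exact h

lemma sphereHom_elt {K : CochainComplex (ModuleCat.{u} S) ℤ} (n : ℤ) (x : K.X (n + 1)) (hx) :
    (sphereHom n x hx).f (n + 1) (sphereElt n) = x := by
  have h1 : (sphereHom n x hx).f (n + 1) = (sphereIso S n).hom ≫
      ModuleCat.ofHom (LinearMap.toSpanSingleton S _ x) := mkHomFromSingle_f ..
  have h : (sphereIso S n).inv ≫ (sphereHom n x hx).f (n + 1) =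
      ModuleCat.ofHom (LinearMap.toSpanSingleton S _ x) := by
    rw [h1, Iso.inv_hom_id_assoc]
  exact (ConcreteCategory.congr_hom h (1 : S)).trans (one_smul S x)

lemma sphere_hom_ext {K : CochainComplex (ModuleCat.{u} S) ℤ} {n : ℤ} {f g : sphere S n ⟶ K}
    (h : f.f (n + 1) (sphereElt n) = g.f (n + 1) (sphereElt n)) : f = g := by
  apply from_single_hom_ext
  rw [← cancel_epi (singleObjXSelf (ComplexShape.up ℤ) (n + 1) (ModuleCat.of S S)).inv]
  apply ModuleCat.hom_ext
  apply LinearMap.ext_ring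
  exact h

lemma d_sphereElt (n : ℤ) (j : ℤ) : (sphere S n).d (n + 1) j (sphereElt n) = 0 := by
  have : (sphere S n).d (n + 1) j = 0 := single_obj_d ..
  simp [this]

variable (S) in
/-- The inclusion of the boundary of the disk. -/
noncomputable def diskIncl (n : ℤ) : sphere S n ⟶ disk S n :=
  sphereHom n ((disk S n).d n (n + 1) (diskElt n)) (by
    rw [← ModuleCat.comp_apply]; simp)

lemma diskIncl_elt (n : ℤ) : (diskIncl S n).f (n + 1) (sphereElt n) =
   (disk S n).d n (n + 1) (diskElt n) := sphereHom_elt ..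

instance (n : ℤ) : Mono (diskIncl S n) := by
  have h1 : (sphereIso S n).inv ≫ (diskIncl S n).f (n + 1) = (diskIso₁ S n).inv := by
    apply ModuleCat.hom_ext
    apply LinearMap.ext_ring
    refine (diskIncl_elt n).trans ?_
    have h2 : (diskIso₀ S n).inv ≫ (disk S n).d n (n + 1) = (diskIso₁ S n).inv := by
      rw [disk_d, Iso.inv_hom_id_assoc]
    exact ConcreteCategory.congr_hom h2 (1 : S)
  have : IsIso ((diskIncl S n).f (n + 1)) := by
    have h3 : (diskIncl S n).f (n + 1) = (sphereIso S n).hom ≫ (diskIso₁ S n).inv := by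
      rw [← h1, Iso.hom_inv_id_assoc]
    rw [h3]
    infer_instance
  apply HomologicalComplex.mono_of_mono_f
  intro i
  by_cases hi : i = n + 1
  · subst hi; infer_instance
  · constructor
    intro Z g h _
    apply (isZero_single_obj_X (ComplexShape.up ℤ) (n + 1) (ModuleCat.of S S) i hi).eq_of_tgt

variable (S) in
/-- The maps `0 → Dⁿ` and `Sⁿ⁺¹ → Dⁿ`. -/
noncomputable def cells : MorphismProperty (CochainComplex (ModuleCat.{u} S) ℤ) :=
  ofHoms (fun n : ℤ => (0 : (0 : CochainComplex (ModuleCat.{u} S) ℤ) ⟶ disk S n)) ⊔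
    ofHoms (fun n : ℤ => diskIncl S n)

instance : IsSmall.{u} (cells S) := by
  refine ⟨?_⟩
  have : (cells S).toSet =
      (ofHoms (fun n : ℤ => (0 : (0 : CochainComplex (ModuleCat.{u} S) ℤ) ⟶ disk S n))).toSet ∪
        (ofHoms (fun n : ℤ => diskIncl S n)).toSet := rfl
  rw [this]
  infer_instance

lemma cells_le_mono : cells S ≤ monomorphisms _ := by
  rintro _ _ _ (⟨⟨n⟩⟩ | ⟨⟨n⟩⟩)
  · exact (monomorphisms.iff _).2 inferInstance
  · exact (monomorphisms.iff _).2 inferInstance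

open IsGrothendieckAbelian in
instance : HasSmallObjectArgument.{u} (cells S) := by
  obtain ⟨κ, hκ', hκ⟩ := HasCardinalLT.exists_regular_cardinal.{u}
    (Subobject (0 : CochainComplex (ModuleCat.{u} S) ℤ) ⊕
      (Σ n : ℤ, Subobject (sphere S n)))
  have : Fact κ.IsRegular := ⟨hκ'⟩
  have : Nonempty κ.ord.ToType := by simpa using hκ'.ne_zero
  have := WellFoundedLT.toOrderBot κ.ord.ToType
  exact ⟨κ, inferInstance, inferInstance,
    { preservesColimit {A B X Y} i hi f hf := by
        let hf' : (monomorphisms _).TransfiniteCompositionOfShape κ.ord.ToType f :=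
          { toTransfiniteCompositionOfShape := hf.toTransfiniteCompositionOfShape
            map_mem j hj := by
              have := (hf.attachCells j hj).pushouts_coproducts
              simp only [ofHoms_homFamily] at this
              refine (?_ : _ ≤ monomorphisms _) _ this
              rw [pushouts_le_iff, coproducts_le_iff]
              exact cells_le_mono }
        have (j j' : κ.ord.ToType) (φ : j ⟶ j') : Mono (hf'.F.map φ) := hf'.mem_map φ
        apply preservesColimit_coyoneda_obj_of_mono (Y := hf'.F) (κ := κ)
        obtain (⟨⟨n⟩⟩ | ⟨⟨n⟩⟩) := hi
        · exact hκ.of_injective _ Sum.inl_injective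
        · exact hκ.of_injective (fun a => Sum.inr ⟨n, a⟩) (fun a b h => by simpa using h) }⟩

/-- Epimorphisms of complexes with an acyclic kernel, in terms of elements. -/
def IsTriv {K L : CochainComplex (ModuleCat.{u} S) ℤ} (p : K ⟶ L) : Prop :=
  (∀ n, Function.Surjective (p.f n)) ∧
    ∀ n (x : K.X (n + 1)), K.d (n + 1) (n + 1 + 1) x = 0 → p.f (n + 1) x = 0 →
      ∃ y : K.X n, K.d n (n + 1) y = x ∧ p.f n y = 0

lemma comm_apply {K L : CochainComplex (ModuleCat.{u} S) ℤ} (p : K ⟶ L) (i j : ℤ) (x : K.X i) :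
    p.f j (K.d i j x) = L.d i j (p.f i x) :=
  (ConcreteCategory.congr_hom (p.comm i j) x).symm

lemma d_d_apply (K : CochainComplex (ModuleCat.{u} S) ℤ) (i j k : ℤ) (x : K.X i) :
    K.d j k (K.d i j x) = 0 :=
  (ConcreteCategory.congr_hom (K.d_comp_d i j k) x)

lemma isTriv_of_rlp {K L : CochainComplex (ModuleCat.{u} S) ℤ} (p : K ⟶ L)
    (hp : (cells S).rlp p) : IsTriv p := by
  constructor
  · intro n y
    have := hp (0 : (0 : CochainComplex (ModuleCat.{u} S) ℤ) ⟶ disk S n)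
      (Or.inl (ofHoms.mk (f := fun n : ℤ =>
        (0 : (0 : CochainComplex (ModuleCat.{u} S) ℤ) ⟶ disk S n)) n))
    have sq : CommSq (0 : 0 ⟶ K) 0 p (diskHom n y) := ⟨by simp⟩
    refine ⟨sq.lift.f n (diskElt n), ?_⟩
    rw [← ModuleCat.comp_apply, ← HomologicalComplex.comp_f, sq.fac_right, diskHom_elt]
  · intro n x hx hpx
    have := hp (diskIncl S n) (Or.inr (ofHoms.mk (f := fun n : ℤ => diskIncl S n) n))
    have sq : CommSq (sphereHom n x hx) (diskIncl S n) p 0 := ⟨by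
      apply sphere_hom_ext
      rw [HomologicalComplex.comp_f, ModuleCat.comp_apply, sphereHom_elt, hpx]
      simp⟩
    refine ⟨sq.lift.f n (diskElt n), ?_, ?_⟩
    · rw [← comm_apply, ← diskIncl_elt, ← ModuleCat.comp_apply, ← HomologicalComplex.comp_f,
        sq.fac_left, sphereHom_elt]
    · rw [← ModuleCat.comp_apply, ← HomologicalComplex.comp_f, sq.fac_right]
      simp

lemma rlp_of_isTriv {K L : CochainComplex (ModuleCat.{u} S) ℤ} (p : K ⟶ L)
    (hp : IsTriv p) : (cells S).rlp p := by
  rintro _ _ _ (⟨⟨n⟩⟩ | ⟨⟨n⟩⟩)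
  · constructor
    intro f g sq
    obtain ⟨x, hx⟩ := hp.1 n (g.f n (diskElt n))
    refine ⟨⟨diskHom n x, (isZero_zero _).eq_of_src _ _, ?_⟩⟩
    apply disk_hom_ext
    rw [HomologicalComplex.comp_f, ModuleCat.comp_apply, diskHom_elt, hx]
  · constructor
    intro f g sq
    obtain ⟨c, hc⟩ := hp.1 n (g.f n (diskElt n))
    have h1 : p.f (n + 1) (f.f (n + 1) (sphereElt n)) =
        L.d n (n + 1) (g.f n (diskElt n)) := by
      rw [← comm_apply, ← diskIncl_elt, ← ModuleCat.comp_apply, ← ModuleCat.comp_apply,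
        ← HomologicalComplex.comp_f, ← HomologicalComplex.comp_f, sq.w]
    obtain ⟨y, hy, hy'⟩ := hp.2 n (f.f (n + 1) (sphereElt n) - K.d n (n + 1) c) (by
      rw [map_sub, d_d_apply, ← comm_apply, d_sphereElt]; simp) (by
      rw [map_sub, comm_apply, h1, hc, sub_self])
    refine ⟨⟨diskHom n (y + c), ?_, ?_⟩⟩
    · apply sphere_hom_ext
      rw [HomologicalComplex.comp_f, ModuleCat.comp_apply, diskIncl_elt, comm_apply, diskHom_elt,
        map_add, hy, sub_add_cancel]
    · apply disk_hom_ext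
      rw [HomologicalComplex.comp_f, ModuleCat.comp_apply, diskHom_elt, map_add, hy', hc, zero_add]

lemma exists_of_exactAt {K : CochainComplex (ModuleCat.{u} S) ℤ} (hK : K.Acyclic) (n : ℤ)
    (x : K.X (n + 1)) (hx : K.d (n + 1) (n + 1 + 1) x = 0) : ∃ y : K.X n, K.d n (n + 1) y = x := by
  have := (K.exactAt_iff' n (n + 1) (n + 1 + 1) (by simp) (by simp)).1 (hK (n + 1))
  exact (ShortComplex.moduleCat_exact_iff _).1 this x hx

lemma quasiIso_of_isTriv {K L : CochainComplex (ModuleCat.{u} S) ℤ} (p : K ⟶ L)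
    (hp : IsTriv p) : QuasiIso p := by
  have : Epi p := HomologicalComplex.epi_of_epi_f _ fun n =>
    (ModuleCat.epi_iff_surjective _).2 (hp.1 n)
  have hS : (ShortComplex.mk (kernel.ι p) p (by simp)).ShortExact :=
    { exact := ShortComplex.exact_kernel p }
  have hi (n : ℤ) : Function.Injective ((kernel.ι p).f n) :=
    (ModuleCat.mono_iff_injective _).1 inferInstance
  have hex (n : ℤ) (x : K.X n) (hx : p.f n x = 0) : ∃ y, (kernel.ι p).f n y = x :=
    (ShortComplex.moduleCat_exact_iff _).1
      (hS.exact.map (HomologicalComplex.eval _ _ n)) x hx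
  have hK : (kernel p).Acyclic := by
    intro i
    obtain ⟨n, rfl⟩ : ∃ n, i = n + 1 := ⟨i - 1, by lia⟩
    rw [(kernel p).exactAt_iff' n (n + 1) (n + 1 + 1) (by simp) (by simp),
      ShortComplex.moduleCat_exact_iff]
    suffices h : ∀ x : (kernel p).X (n + 1), (kernel p).d (n + 1) (n + 1 + 1) x = 0 →
      ∃ y : (kernel p).X n, (kernel p).d n (n + 1) y = x from h
    intro x hx
    obtain ⟨y, hy, hy'⟩ := hp.2 n ((kernel.ι p).f (n + 1) x) (by
      rw [← comm_apply, hx, map_zero]) (by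
      rw [← ModuleCat.comp_apply, ← HomologicalComplex.comp_f, kernel.condition]; rfl)
    obtain ⟨z, rfl⟩ := hex n y hy'
    refine ⟨z, hi _ ?_⟩
    rw [← hy, ← comm_apply]
  refine ⟨fun i => (quasiIsoAt_iff_isIso_homologyMap _ _).2 ?_⟩
  have hz (i : ℤ) := (hK i).isZero_homology
  have h1 : Mono (homologyMap p i) :=
    (hS.homology_exact₂ i).mono_g ((hz i).eq_of_src _ _)
  have h2 : Epi (homologyMap p i) :=
    (hS.homology_exact₃ i (i + 1) rfl).epi_f ((hz (i + 1)).eq_of_tgt _ _)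
  exact isIso_of_mono_of_epi _

lemma isZero_quotient_mappingCocone (L : CochainComplex (ModuleCat.{u} S) ℤ) :
    IsZero ((HomotopyCategory.quotient _ _).obj (CochainComplex.mappingCocone (𝟙 L))) := by
  have h : IsZero ((HomotopyCategory.quotient _ (ComplexShape.up ℤ)).obj
      (CochainComplex.mappingCone (𝟙 L))) := by
    rw [IsZero.iff_id_eq_zero, ← CategoryTheory.Functor.map_id,
      HomotopyCategory.eq_of_homotopy _ _ (CochainComplex.mappingCone.homotopyToZeroOfId L),
      Functor.map_zero]
  exact ((shiftFunctor (HomotopyCategory (ModuleCat.{u} S) (ComplexShape.up ℤ))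
    (-1 : ℤ)).map_isZero h).of_iso
      (((HomotopyCategory.quotient _ (ComplexShape.up ℤ)).commShiftIso (-1 : ℤ)).app _)

lemma isTriv_fst (L : CochainComplex (ModuleCat.{u} S) ℤ) (hL : L.Acyclic) :
    IsTriv (CochainComplex.mappingCocone.fst (𝟙 L)) := by
  have hC : (CochainComplex.mappingCocone (𝟙 L)).Acyclic := by
    rw [← HomotopyCategory.quotient_obj_mem_subcategoryAcyclic_iff_acyclic]
    exact ObjectProperty.prop_of_isZero _ (isZero_quotient_mappingCocone L)
  have hs (n : ℤ) : Function.Surjective ((CochainComplex.mappingCocone.fst (𝟙 L)).f n) := fun y =>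
    ⟨(CochainComplex.mappingCocone.inl (𝟙 L)).v n n (add_zero n) y, by
      rw [← ModuleCat.comp_apply, CochainComplex.mappingCocone.inl_v_fst_f]; rfl⟩
  refine ⟨hs, fun n x hx hpx => ?_⟩
  obtain ⟨y, rfl⟩ := exists_of_exactAt hC n x hx
  rw [comm_apply] at hpx
  obtain ⟨m, rfl⟩ : ∃ m, n = m + 1 := ⟨n - 1, by lia⟩
  obtain ⟨l, hl⟩ := exists_of_exactAt hL m _ hpx
  obtain ⟨c, rfl⟩ := hs m l
  refine ⟨y - (CochainComplex.mappingCocone (𝟙 L)).d m (m + 1) c, ?_, ?_⟩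
  · rw [map_sub, d_d_apply, sub_zero]
  · rw [map_sub, comm_apply, hl, sub_self]

/-- Every complex of modules has a K-projective resolution. -/
lemma exists_kProjective (X : CochainComplex (ModuleCat.{u} S) ℤ) :
    ∃ (P : CochainComplex (ModuleCat.{u} S) ℤ) (p : P ⟶ X), P.IsKProjective ∧ QuasiIso p := by
  let fac := (functorialFactorizationData (cells S).rlp.llp (cells S).rlp).factorizationData
    (0 : 0 ⟶ X)
  refine ⟨fac.Z, fac.p, ⟨fun {L} f hL => ?_⟩, quasiIso_of_isTriv _ (isTriv_of_rlp _ fac.hp)⟩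
  have := fac.hi _ (rlp_of_isTriv _ (isTriv_fst L hL))
  have sq : CommSq 0 fac.i (CochainComplex.mappingCocone.fst (𝟙 L)) f :=
    ⟨(isZero_zero _).eq_of_src _ _⟩
  refine ⟨HomotopyCategory.homotopyOfEq _ _ ?_⟩
  rw [← sq.fac_right, Functor.map_comp, Functor.map_zero,
    (isZero_quotient_mappingCocone L).eq_of_tgt ((HomotopyCategory.quotient _ _).map sq.lift) 0,
    zero_comp]


variable [HasDerivedCategory (ModuleCat.{u} S)]

/-- Every functor on the homotopy category of modules has a left derived functor. -/
instance {H : Type*} [Category* H] (F : HomotopyCategory (ModuleCat.{u} S) (ComplexShape.up ℤ) ⥤ H) :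
    F.HasPointwiseLeftDerivedFunctor (HomotopyCategory.quasiIso _ _) := by
  intro X
  obtain ⟨X, rfl⟩ := HomotopyCategory.quotient_obj_surjective X
  rw [F.hasPointwiseLeftDerivedFunctorAt_iff DerivedCategory.Qh]
  obtain ⟨P, p, hP, hp⟩ := exists_kProjective X
  let q := (HomotopyCategory.quotient _ _).map p
  have : IsIso (DerivedCategory.Qh.map q) := Localization.inverts DerivedCategory.Qh
    (HomotopyCategory.quasiIso _ _) q ((HomotopyCategory.quotient_map_mem_quasiIso_iff p).2 hp)
  let a : StructuredArrow (DerivedCategory.Qh.obj ((HomotopyCategory.quotient _ _).obj X))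
    DerivedCategory.Qh := StructuredArrow.mk (Y := (HomotopyCategory.quotient _ _).obj P)
      (inv (DerivedCategory.Qh.map q))
  have hs (b : StructuredArrow (DerivedCategory.Qh.obj ((HomotopyCategory.quotient _ _).obj X))
      DerivedCategory.Qh) := (CochainComplex.IsKProjective.Qh_map_bijective P b.right).2
        (DerivedCategory.Qh.map q ≫ b.hom)
  have ha : IsInitial a := IsInitial.ofUniqueHom
    (fun b => StructuredArrow.homMk (hs b).choose (by
      change inv (DerivedCategory.Qh.map q) ≫ DerivedCategory.Qh.map (hs b).choose = b.hom
      rw [(hs b).choose_spec, IsIso.inv_hom_id_assoc])) (fun b f => by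
      apply StructuredArrow.hom_ext
      apply (CochainComplex.IsKProjective.Qh_map_bijective P b.right).1
      refine Eq.trans ?_ (hs b).choose_spec.symm
      have h : inv (DerivedCategory.Qh.map q) ≫ DerivedCategory.Qh.map f.right = b.hom :=
        StructuredArrow.w f
      rw [← h, IsIso.hom_inv_id_assoc])
  have := ha.hasInitial
  unfold Functor.HasPointwiseRightKanExtensionAt
  infer_instance

end KProj

section Derived
open Limits

variable (R S : Type u) [Ring R] [Ring S]
variable (ω : Type u) [AddCommGroup ω] [Module R ω] [Module Sᵐᵒᵖ ω] [SMulCommClass R Sᵐᵒᵖ ω]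

/-- The evaluation maps `ω ⊗_S Hom_R(ω, K) → K` for complexes `K`, up to homotopy. -/
noncomputable def evalHomotopy :
    (homFunctor R S ω).mapHomotopyCategory (ComplexShape.up ℤ) ⋙
      (tensorFunctor R S ω).mapHomotopyCategory (ComplexShape.up ℤ) ⟶
      𝟭 (HomotopyCategory (ModuleCat.{u} R) (ComplexShape.up ℤ)) where
  app K := (HomotopyCategory.quotient _ _).map
    ((NatTrans.mapHomologicalComplex (evalNat R S ω) (ComplexShape.up ℤ)).app K.as)
  naturality K L f := by
    obtain ⟨K, rfl⟩ := HomotopyCategory.quotient_obj_surjective K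
    obtain ⟨L, rfl⟩ := HomotopyCategory.quotient_obj_surjective L
    obtain ⟨f, rfl⟩ := (HomotopyCategory.quotient _ _).map_surjective f
    exact congrArg (HomotopyCategory.quotient _ _).map
      ((NatTrans.mapHomologicalComplex (evalNat R S ω) (ComplexShape.up ℤ)).naturality f)

variable [HasDerivedCategory.{w} (ModuleCat.{u} R)] [HasDerivedCategory.{w'} (ModuleCat.{u} S)]

/-- The right derived functor `RHom_R(ω, -) : D⁺(R) ⥤ D⁺(S)`. -/
noncomputable def rHom :
    DerivedCategory.Plus (ModuleCat.{u} R) ⥤ DerivedCategory.Plus (ModuleCat.{u} S) :=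
  (homFunctor R S ω).rightDerivedFunctorPlus

/-- The canonical map from `Hom_R(ω, K)` to `RHom_R(ω, K)`. -/
noncomputable def rHomUnit :
    (homFunctor R S ω).mapHomotopyCategoryPlus ⋙ DerivedCategory.Plus.Qh ⟶
      DerivedCategory.Plus.Qh ⋙ rHom R S ω :=
  (homFunctor R S ω).rightDerivedFunctorPlusUnit

instance : (rHom R S ω).IsRightDerivedFunctor (rHomUnit R S ω)
    (HomotopyCategory.Plus.quasiIso (ModuleCat.{u} R)) := by
  unfold rHom rHomUnit
  infer_instance

/-- The left derived functor `ω ⊗ᴸ_S - : D(S) ⥤ D(R)`. -/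
noncomputable def lTensor :
    DerivedCategory (ModuleCat.{u} S) ⥤ DerivedCategory (ModuleCat.{u} R) :=
  ((tensorFunctor R S ω).mapHomotopyCategory (ComplexShape.up ℤ) ⋙
    DerivedCategory.Qh).totalLeftDerived DerivedCategory.Qh (HomotopyCategory.quasiIso _ _)

/-- The canonical map from `ω ⊗ᴸ_S K` to `ω ⊗_S K`. -/
noncomputable def lTensorCounit :
    DerivedCategory.Qh ⋙ lTensor R S ω ⟶
      (tensorFunctor R S ω).mapHomotopyCategory (ComplexShape.up ℤ) ⋙ DerivedCategory.Qh :=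
  ((tensorFunctor R S ω).mapHomotopyCategory (ComplexShape.up ℤ) ⋙
    DerivedCategory.Qh).totalLeftDerivedCounit DerivedCategory.Qh
      (HomotopyCategory.quasiIso _ _)

instance : (lTensor R S ω).IsLeftDerivedFunctor (lTensorCounit R S ω)
    (HomotopyCategory.quasiIso (ModuleCat.{u} S) (ComplexShape.up ℤ)) := by
  unfold lTensor lTensorCounit
  infer_instance

/-- The functor `ω ⊗ᴸ_S RHom_R(ω, -) : D⁺(R) ⥤ D(R)`. -/
noncomputable def lTensorRHom :
    DerivedCategory.Plus (ModuleCat.{u} R) ⥤ DerivedCategory (ModuleCat.{u} R) :=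
  rHom R S ω ⋙ DerivedCategory.Plus.ι ⋙ lTensor R S ω

/-- The canonical map from `ω ⊗ᴸ_S Hom_R(ω, K)` to `ω ⊗ᴸ_S RHom_R(ω, K)`. -/
noncomputable def lTensorRHomUnit :
    (homFunctor R S ω).mapHomotopyCategoryPlus ⋙ DerivedCategory.Plus.Qh ⋙
      DerivedCategory.Plus.ι ⋙ lTensor R S ω ⟶
    DerivedCategory.Plus.Qh ⋙ lTensorRHom R S ω :=
  Functor.whiskerRight (rHomUnit R S ω) (DerivedCategory.Plus.ι ⋙ lTensor R S ω)

/-- `ω ⊗ᴸ_S RHom_R(ω, -)` is the right derived functor of `K ↦ ω ⊗ᴸ_S Hom_R(ω, K)`. -/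
instance : (lTensorRHom R S ω).IsRightDerivedFunctor (lTensorRHomUnit R S ω)
    (HomotopyCategory.Plus.quasiIso (ModuleCat.{u} R)) := by
  apply (HomotopyCategory.Plus.localizerMorphism_derives _).isRightDerivedFunctor_of_isIso
  intro X
  have : IsIso ((rHomUnit R S ω).app
      ((InjectiveObject.ι (ModuleCat.{u} R)).mapHomotopyCategoryPlus.obj X)) := by
    unfold rHomUnit rHom
    infer_instance
  exact inferInstanceAs (IsIso ((DerivedCategory.Plus.ι ⋙ lTensor R S ω).map
    ((rHomUnit R S ω).app ((InjectiveObject.ι (ModuleCat.{u} R)).mapHomotopyCategoryPlus.obj X))))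

/-- The composite `ω ⊗ᴸ_S Hom_R(ω, K) → ω ⊗_S Hom_R(ω, K) → K` for bounded below complexes `K`. -/
noncomputable def evalPlus :
    (homFunctor R S ω).mapHomotopyCategoryPlus ⋙ DerivedCategory.Plus.Qh ⋙
      DerivedCategory.Plus.ι ⋙ lTensor R S ω ⟶
    DerivedCategory.Plus.Qh ⋙ DerivedCategory.Plus.ι :=
  Functor.whiskerLeft
    (HomotopyCategory.Plus.ι _ ⋙ (homFunctor R S ω).mapHomotopyCategory (ComplexShape.up ℤ))
    (lTensorCounit R S ω) ≫
  Functor.whiskerRight (Functor.whiskerLeft (HomotopyCategory.Plus.ι _) (evalHomotopy R S ω))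
    DerivedCategory.Qh

/-- The canonical morphism `ω ⊗ᴸ_S RHom_R(ω, M) → M`, for `M` in `D⁺(R)`. -/
noncomputable def derivedEval :
    lTensorRHom R S ω ⟶ DerivedCategory.Plus.ι (C := ModuleCat.{u} R) :=
  (lTensorRHom R S ω).rightDerivedDesc (lTensorRHomUnit R S ω)
    (HomotopyCategory.Plus.quasiIso (ModuleCat.{u} R)) DerivedCategory.Plus.ι (evalPlus R S ω)

end Derived

section Bass

/-- The bounded derived category `D^b(R)`: the full subcategory of the derived category of left
`R`-modules given by the objects whose cohomology vanishes in all but finitely many degrees. -/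
abbrev Db (R : Type u) [Ring R] [HasDerivedCategory.{w} (ModuleCat.{u} R)] :=
  (DerivedCategory.TStructure.t (C := ModuleCat.{u} R)).bounded.FullSubcategory

/-- The inclusion `D^b(R) ⥤ D⁺(R)`. -/
noncomputable abbrev Db.toPlus (R : Type u) [Ring R] [HasDerivedCategory.{w} (ModuleCat.{u} R)] :
    Db R ⥤ DerivedCategory.Plus (ModuleCat.{u} R) :=
  ObjectProperty.ιOfLE inf_le_left

/-- A bounded complex of left `R`-modules (zero outside of degrees `a`, ..., `b`),
as an object of `D^b(R)`. -/
noncomputable def Db.ofComplex {R : Type u} [Ring R] [HasDerivedCategory.{w} (ModuleCat.{u} R)]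
    (Y : CochainComplex (ModuleCat.{u} R) ℤ) (a b : ℤ)
    (ha : Y.IsStrictlyGE a) (hb : Y.IsStrictlyLE b) : Db R :=
  ⟨DerivedCategory.Q.obj Y, ⟨a, inferInstance⟩, ⟨b, inferInstance⟩⟩

/-- The supremum of the degrees in which the cohomology is nonzero (`⊥` for the zero object). -/
noncomputable def cohomSup {R : Type u} [Ring R] [HasDerivedCategory.{w} (ModuleCat.{u} R)]
    (X : DerivedCategory (ModuleCat.{u} R)) : WithBot (WithTop ℤ) :=
  sSup {x | ∃ n : ℤ, ¬ Limits.IsZero ((DerivedCategory.homologyFunctor _ n).obj X) ∧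
    x = ((n : WithTop ℤ) : WithBot (WithTop ℤ))}

variable (R S : Type u) [Ring R] [Ring S]
variable (ω : Type u) [AddCommGroup ω] [Module R ω] [Module Sᵐᵒᵖ ω] [SMulCommClass R Sᵐᵒᵖ ω]

/-- Semidualizing `(R, S)`-bimodules. Right `S`-modules are modules over `Sᵐᵒᵖ`. -/
structure IsSemidualizing : Prop where
  left_resolution : ∃ P : ProjectiveResolution (ModuleCat.of R ω),
    ∀ n, Module.Finite R (P.complex.X n)
  right_resolution : ∃ P : ProjectiveResolution (ModuleCat.of Sᵐᵒᵖ ω),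
    ∀ n, Module.Finite Sᵐᵒᵖ (P.complex.X n)
  left_homothety : Function.Bijective (leftHomothety R S ω)
  right_homothety : Function.Bijective (rightHomothety R S ω)
  left_ext : ∀ n : ℕ, 1 ≤ n →
    Subsingleton (Abelian.Ext (ModuleCat.of R ω) (ModuleCat.of R ω) n)
  right_ext : ∀ n : ℕ, 1 ≤ n →
    Subsingleton (Abelian.Ext (ModuleCat.of Sᵐᵒᵖ ω) (ModuleCat.of Sᵐᵒᵖ ω) n)

/-- The Bass class of modules: `Ext_R^i(ω, M) = 0` and `Tor_i^S(ω, Hom_R(ω, M)) = 0` for `i ≥ 1`,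
and the evaluation map `ω ⊗_S Hom_R(ω, M) → M` is an isomorphism. -/
structure IsBass (M : ModuleCat.{u} R) : Prop where
  ext : ∀ n : ℕ, 1 ≤ n → Subsingleton (Abelian.Ext (ModuleCat.of R ω) M n)
  tor : ∀ n : ℕ, 1 ≤ n →
    Limits.IsZero (((tensorFunctor R S ω).leftDerived n).obj ((homFunctor R S ω).obj M))
  static : IsIso ((evalNat R S ω).app M)

variable [HasDerivedCategory.{w} (ModuleCat.{u} R)] [HasDerivedCategory.{w'} (ModuleCat.{u} S)]

/-- The Bass class of complexes: the objects `M` of `D^b(R)` such that `RHom_R(ω, M)` lies in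
`D^b(S)` and the canonical morphism `ω ⊗ᴸ_S RHom_R(ω, M) → M` is an isomorphism. -/
structure IsBassComplex (M : Db R) : Prop where
  bounded : (DerivedCategory.TStructure.t (C := ModuleCat.{u} S)).bounded
    ((rHom R S ω).obj ((Db.toPlus R).obj M)).obj
  isIso : IsIso ((derivedEval R S ω).app ((Db.toPlus R).obj M))

open scoped Classical in
/-- The Bass injective dimension of an object of `D^b(R)`. -/
noncomputable def bassInjDim (M : Db R) : WithBot (WithTop ℤ) :=
  if IsBassComplex R S ω M then cohomSup ((rHom R S ω).obj ((Db.toPlus R).obj M)).obj else ⊤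

end Bass
end BassClass

/-! Finite Bass injective dimension amounts to membership in the Bass class of complexes, because
there `RHom_R(ω, M)` has bounded cohomology (`bassInjDim_lt_top_iff`). Membership can be tested on
any bounded below complex `K` representing `M` whose terms have no higher `Ext_R(ω, -)` and a
bijective evaluation map. Then `N = Hom_R(ω, K)` computes `RHom_R(ω, M)`, and the canonical morphism
becomes `ω ⊗ᴸ N → ω ⊗ N ≅ K`. So `M` is in the class iff `N` has bounded cohomology and `ω ⊗ᴸ N → ω
⊗ N` is an isomorphism, i.e. `N` is `tensorAcyclic` (`isBassComplex_iff`).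

For (2) ⇒ (1), take `K = Y`. Then `N` is bounded with terms having no higher `Tor`, and such
complexes are `tensorAcyclic` by induction on their length (`tensorAcyclic_of_bounded`).

For (1) ⇒ (2), take for `K` an injective resolution `I`. Injective modules are Bass modules
(`isBass_of_injective`): for a finitely presented right `S`-module `A` and `E` injective, `A ⊗_S
Hom_R(ω, E) ≅ Hom_R(Hom_{S^op}(A, ω), E)`, which turns `Tor` into `Ext_{S^op}(ω, ω)` and, for `A =
ω`, evaluation into the homothety isomorphism.

Choose `n` bounding the cohomology of both `I` and `N` from above. The canonical truncation of `I`
in degrees `≤ n` still represents `M`, and only its top term, the cocycle module `Zⁿ`, need not be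
injective; it is a Bass module by `isBass_cyc`. Its `Ext` vanishes by dimension shifting, since `Zⁿ
→ Iⁿ → Iⁿ⁺¹ → ⋯` stays exact under `Hom_R(ω, -)`. Discarding the degrees `< n` of `N` removes a
bounded complex of modules without higher `Tor`, so the remaining part is `tensorAcyclic`; it is a
right resolution of `Hom_R(ω, Zⁿ)`. Thus `ω ⊗ᴸ Hom_R(ω, Zⁿ)` is computed by a complex starting in
degree `n`. This kills the higher `Tor` and identifies `ω ⊗ Hom_R(ω, Zⁿ)` with the kernel of `ω ⊗ Nⁿ
→ ω ⊗ Nⁿ⁺¹`, that is of `Iⁿ → Iⁿ⁺¹`. -/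

namespace BassClass

/-! ### Complexes on which the tensor product agrees with its derived functor. -/

section TensorAcyclic
open Limits Pretriangulated

variable (R S : Type u) [Ring R] [Ring S]
variable (ω : Type u) [AddCommGroup ω] [Module R ω] [Module Sᵐᵒᵖ ω]
variable [HasDerivedCategory.{w} (ModuleCat.{u} R)] [HasDerivedCategory.{w'} (ModuleCat.{u} S)]

/-- The functor `ω ⊗_S -` on homotopy categories. -/
noncomputable abbrev hTensor : HomotopyCategory (ModuleCat.{u} S) (ComplexShape.up ℤ) ⥤
    HomotopyCategory (ModuleCat.{u} R) (ComplexShape.up ℤ) :=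
  (tensorFunctor R S ω).mapHomotopyCategory (ComplexShape.up ℤ)

/-- The complexes `K` such that `ω ⊗ᴸ_S K → ω ⊗_S K` is an isomorphism. -/
def tensorAcyclic : ObjectProperty (HomotopyCategory (ModuleCat.{u} S) (ComplexShape.up ℤ)) :=
  fun K => IsIso ((lTensorCounit R S ω).app K)

instance : (tensorAcyclic R S ω).IsClosedUnderIsomorphisms where
  of_iso e h := (NatTrans.isIso_app_iff_of_iso (lTensorCounit R S ω) e).1 h

variable {S}

/-- Left orthogonality to acyclic complexes is K-projectivity, so morphisms out of `K` are the same
in the homotopy and derived categories. The pointwise Kan extension defining `lTensor` is then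
attained at the identity of `K`. -/
lemma tensorAcyclic_of_leftOrthogonal
    (K : HomotopyCategory (ModuleCat.{u} S) (ComplexShape.up ℤ))
    (hK : (HomotopyCategory.subcategoryAcyclic (ModuleCat.{u} S)).leftOrthogonal K) :
    tensorAcyclic R S ω K := by
  obtain ⟨K, rfl⟩ := HomotopyCategory.quotient_obj_surjective K
  have : CochainComplex.IsKProjective K := (CochainComplex.isKProjective_iff_leftOrthogonal K).2 hK
  let h := Functor.isPointwiseRightKanExtensionOfHasPointwiseLeftDerivedFunctor
    (lTensor R S ω) (lTensorCounit R S ω)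
    (HomotopyCategory.quasiIso (ModuleCat.{u} S) (ComplexShape.up ℤ))
    (DerivedCategory.Qh.obj ((HomotopyCategory.quotient _ _).obj K))
  -- The identity arrow is initial in the category indexing the limit, so the projection of the
  -- limit at this arrow, which is the counit, is an isomorphism.
  let a : StructuredArrow (DerivedCategory.Qh.obj ((HomotopyCategory.quotient _ _).obj K))
    DerivedCategory.Qh := StructuredArrow.mk (𝟙 _)
  have hs (b : StructuredArrow (DerivedCategory.Qh.obj ((HomotopyCategory.quotient _ _).obj K))
      DerivedCategory.Qh) := (CochainComplex.IsKProjective.Qh_map_bijective K b.right)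
  have ha : IsInitial a := IsInitial.ofUniqueHom
    (fun b => StructuredArrow.homMk ((hs b).2 b.hom).choose (by
      change 𝟙 _ ≫ _ = _
      rw [((hs b).2 b.hom).choose_spec, Category.id_comp]))
    (fun b f => by
      apply StructuredArrow.hom_ext
      apply (hs b).1
      refine Eq.trans ?_ ((hs b).2 b.hom).choose_spec.symm
      have := StructuredArrow.w f
      rwa [show a.hom = 𝟙 _ from rfl, Category.id_comp] at this)
  have h' := h.isIso_π_app_of_isInitial _ ha
  simp only [a, Functor.comp_obj, Functor.RightExtension.coneAt_π_app, StructuredArrow.mk_right,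
    StructuredArrow.mk_hom_eq_self, Functor.RightExtension.mk_hom] at h'
  exact (isIso_comp_left_iff ((lTensor R S ω).map (𝟙 _)) _).1 h'

variable {R ω}

/-- Naturality square of the counit at `f`: the derived tensor product inverts `f` and the counit at
`P` is invertible, so the two remaining sides are invertible together. -/
lemma tensorAcyclic_iff {P K : HomotopyCategory (ModuleCat.{u} S) (ComplexShape.up ℤ)}
    (f : P ⟶ K) (hP : tensorAcyclic R S ω P) [IsIso (DerivedCategory.Qh.map f)] :
    tensorAcyclic R S ω K ↔ IsIso (DerivedCategory.Qh.map ((hTensor R S ω).map f)) := by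
  have : IsIso ((lTensorCounit R S ω).app P) := hP
  have h := (lTensorCounit R S ω).naturality f
  dsimp at h
  constructor
  · intro (hK : IsIso ((lTensorCounit R S ω).app K))
    have := isIso_comp_left_iff ((lTensorCounit R S ω).app P)
      (DerivedCategory.Qh.map ((hTensor R S ω).map f))
    rw [← this]
    erw [← h]
    infer_instance
  · intro hf
    have h' : IsIso ((lTensor R S ω).map (DerivedCategory.Qh.map f) ≫
      (lTensorCounit R S ω).app K) := by
      rw [h]
      infer_instance
    exact (isIso_comp_left_iff _ _).1 h'

lemma exists_leftOrthogonal (K : HomotopyCategory (ModuleCat.{u} S) (ComplexShape.up ℤ)) :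
    ∃ (P : HomotopyCategory (ModuleCat.{u} S) (ComplexShape.up ℤ)) (f : P ⟶ K),
      (HomotopyCategory.subcategoryAcyclic (ModuleCat.{u} S)).leftOrthogonal P ∧
        IsIso (DerivedCategory.Qh.map f) := by
  obtain ⟨K, rfl⟩ := HomotopyCategory.quotient_obj_surjective K
  obtain ⟨P, p, hP, hp⟩ := exists_kProjective K
  exact ⟨_, (HomotopyCategory.quotient _ _).map p,
    (CochainComplex.isKProjective_iff_leftOrthogonal P).1 hP,
    Localization.inverts DerivedCategory.Qh (HomotopyCategory.quasiIso _ _) _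
      ((HomotopyCategory.quotient_map_mem_quasiIso_iff p).2 hp)⟩

/-- Resolve the first two vertices, lift the first map to the resolutions, and take its cone. The
cone is again K-projective because left orthogonals are triangulated, and it resolves the third
vertex by two-out-of-three in the derived category. -/
lemma exists_triangle_resolution
    (T : Triangle (HomotopyCategory (ModuleCat.{u} S) (ComplexShape.up ℤ)))
    (hT : T ∈ distTriang _) :
    ∃ (T' : Triangle (HomotopyCategory (ModuleCat.{u} S) (ComplexShape.up ℤ))) (φ : T' ⟶ T),
      T' ∈ distTriang _ ∧
      ((HomotopyCategory.subcategoryAcyclic (ModuleCat.{u} S)).leftOrthogonal T'.obj₁ ∧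
        IsIso (DerivedCategory.Qh.map φ.hom₁)) ∧
      ((HomotopyCategory.subcategoryAcyclic (ModuleCat.{u} S)).leftOrthogonal T'.obj₂ ∧
        IsIso (DerivedCategory.Qh.map φ.hom₂)) ∧
      ((HomotopyCategory.subcategoryAcyclic (ModuleCat.{u} S)).leftOrthogonal T'.obj₃ ∧
        IsIso (DerivedCategory.Qh.map φ.hom₃)) := by
  obtain ⟨P₁, p₁, h₁, _⟩ := exists_leftOrthogonal T.obj₁
  obtain ⟨P₂, p₂, h₂, _⟩ := exists_leftOrthogonal T.obj₂
  have b (L) : Function.Bijective (DerivedCategory.Qh.map : (P₁ ⟶ L) → _) :=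
    h₁.map_bijective_of_isTriangulated _ L
  obtain ⟨f, hf⟩ := (b P₂).2
    (DerivedCategory.Qh.map (p₁ ≫ T.mor₁) ≫ inv (DerivedCategory.Qh.map p₂))
  have comm : f ≫ p₂ = p₁ ≫ T.mor₁ := (b T.obj₂).1 (by
    rw [Functor.map_comp, hf, Category.assoc, IsIso.inv_hom_id, Category.comp_id])
  obtain ⟨P₃, g, h, hT'⟩ := distinguished_cocone_triangle f
  let φ := completeDistinguishedTriangleMorphism _ _ hT' hT p₁ p₂ comm
  refine ⟨_, φ, hT', ⟨h₁, ‹_›⟩, ⟨h₂, ‹_›⟩, ?_, ?_⟩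
  · exact ObjectProperty.ext_of_isTriangulatedClosed₃ _ _ hT' h₁ h₂
  · exact isIso₃_of_isIso₁₂ (DerivedCategory.Qh.mapTriangle.map φ)
      (DerivedCategory.Qh.map_distinguished _ hT') (DerivedCategory.Qh.map_distinguished _ hT)
      (by assumption) (by assumption)

/-- After a K-projective resolution of the triangle, being `tensorAcyclic` at each vertex means that
a component of a morphism of distinguished triangles is invertible. -/
lemma tensorAcyclic_two_of_three
    (T : Triangle (HomotopyCategory (ModuleCat.{u} S) (ComplexShape.up ℤ)))
    (hT : T ∈ distTriang _) :
    (tensorAcyclic R S ω T.obj₁ → tensorAcyclic R S ω T.obj₂ → tensorAcyclic R S ω T.obj₃) ∧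
    (tensorAcyclic R S ω T.obj₁ → tensorAcyclic R S ω T.obj₃ → tensorAcyclic R S ω T.obj₂) ∧
    (tensorAcyclic R S ω T.obj₂ → tensorAcyclic R S ω T.obj₃ → tensorAcyclic R S ω T.obj₁) := by
  obtain ⟨T', φ, hT', ⟨h₁, _⟩, ⟨h₂, _⟩, ⟨h₃, _⟩⟩ := exists_triangle_resolution T hT
  rw [tensorAcyclic_iff φ.hom₁ (tensorAcyclic_of_leftOrthogonal R ω _ h₁),
    tensorAcyclic_iff φ.hom₂ (tensorAcyclic_of_leftOrthogonal R ω _ h₂),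
    tensorAcyclic_iff φ.hom₃ (tensorAcyclic_of_leftOrthogonal R ω _ h₃)]
  have d₁ := DerivedCategory.Qh.map_distinguished _ ((hTensor R S ω).map_distinguished _ hT')
  have d₂ := DerivedCategory.Qh.map_distinguished _ ((hTensor R S ω).map_distinguished _ hT)
  let ψ := DerivedCategory.Qh.mapTriangle.map ((hTensor R S ω).mapTriangle.map φ)
  exact ⟨fun h h' => isIso₃_of_isIso₁₂ ψ d₁ d₂ h h', fun h h' => isIso₂_of_isIso₁₃ ψ d₁ d₂ h h',
    fun h h' => isIso₁_of_isIso₂₃ ψ d₁ d₂ h h'⟩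

lemma tensorAcyclic_of_isZero (K : HomotopyCategory (ModuleCat.{u} S) (ComplexShape.up ℤ))
    (hK : IsZero K) : tensorAcyclic R S ω K :=
  tensorAcyclic_of_leftOrthogonal R ω K fun _ _ _ => hK.eq_of_src _ _

/-- Two-out-of-three for the triangle `K → 0 → K[1]`. -/
lemma tensorAcyclic_shift_one_iff (K : HomotopyCategory (ModuleCat.{u} S) (ComplexShape.up ℤ)) :
    tensorAcyclic R S ω (K⟦(1 : ℤ)⟧) ↔ tensorAcyclic R S ω K := by
  have h := tensorAcyclic_two_of_three (R := R) (ω := ω) _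
    (rot_of_distTriang _ (contractible_distinguished K))
  have h0 := tensorAcyclic_of_isZero (R := R) (ω := ω) _
    (isZero_zero (HomotopyCategory (ModuleCat.{u} S) (ComplexShape.up ℤ)))
  exact ⟨h.2.2 h0, fun h' => h.1 h' h0⟩

lemma tensorAcyclic_shift_iff (K : HomotopyCategory (ModuleCat.{u} S) (ComplexShape.up ℤ))
    (n : ℤ) : tensorAcyclic R S ω (K⟦n⟧) ↔ tensorAcyclic R S ω K := by
  induction n using Int.induction_on with
  | zero => exact (tensorAcyclic R S ω).prop_iff_of_iso ((shiftFunctorZero _ ℤ).app K)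
  | succ n ih =>
    rw [← ih, ← tensorAcyclic_shift_one_iff (K⟦(n : ℤ)⟧)]
    exact (tensorAcyclic R S ω).prop_iff_of_iso ((shiftFunctorAdd' _ (n : ℤ) 1 _ rfl).app K)
  | pred n ih =>
    rw [← ih, ← tensorAcyclic_shift_one_iff (K⟦(-n - 1 : ℤ)⟧)]
    exact (tensorAcyclic R S ω).prop_iff_of_iso
      ((shiftFunctorAdd' _ (-n - 1 : ℤ) 1 (-n) (by lia)).symm.app K)

end TensorAcyclic

/-! ### Tensor products of a right and a left `S`-module as abelian groups, needed because syzygies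
of `ω` over `Sᵐᵒᵖ` carry no `R`-action. -/

section BalancedTensor

/-- The subgroup of `A ⊗_ℤ N` generated by the elements `as ⊗ n - a ⊗ sn`. -/
def balancedRel (S A N : Type u) [Ring S] [AddCommGroup A] [Module Sᵐᵒᵖ A]
    [AddCommGroup N] [Module S N] : Submodule ℤ (A ⊗[ℤ] N) :=
  Submodule.span ℤ {z | ∃ (x : A) (s : S) (n : N),
    z = (MulOpposite.op s • x) ⊗ₜ[ℤ] n - x ⊗ₜ[ℤ] (s • n)}

/-- The abelian group `A ⊗_S N`, for a right `S`-module `A` and a left `S`-module `N`. -/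
abbrev BalancedTensor (S A N : Type u) [Ring S] [AddCommGroup A] [Module Sᵐᵒᵖ A]
    [AddCommGroup N] [Module S N] : Type u :=
  (A ⊗[ℤ] N) ⧸ balancedRel S A N

namespace BalancedTensor

variable {S : Type u} [Ring S]
variable {A A' A'' N N' N'' : Type u} [AddCommGroup A] [Module Sᵐᵒᵖ A] [AddCommGroup A']
  [Module Sᵐᵒᵖ A'] [AddCommGroup A''] [Module Sᵐᵒᵖ A''] [AddCommGroup N] [Module S N]
  [AddCommGroup N'] [Module S N'] [AddCommGroup N''] [Module S N'']

variable (S) in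
/-- The element `a ⊗ n` of `A ⊗_S N`. -/
def tmul (a : A) (n : N) : BalancedTensor S A N := (balancedRel S A N).mkQ (a ⊗ₜ[ℤ] n)

lemma add_tmul (a a' : A) (n : N) : tmul S (a + a') n = tmul S a n + tmul S a' n :=
  congrArg (balancedRel S A N).mkQ (TensorProduct.add_tmul a a' n)

lemma tmul_add (a : A) (n n' : N) : tmul S a (n + n') = tmul S a n + tmul S a n' :=
  congrArg (balancedRel S A N).mkQ (TensorProduct.tmul_add a n n')

lemma zero_tmul (n : N) : tmul S (0 : A) n = 0 :=
  congrArg (balancedRel S A N).mkQ (TensorProduct.zero_tmul A n)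

lemma tmul_zero (a : A) : tmul S a (0 : N) = 0 :=
  congrArg (balancedRel S A N).mkQ (TensorProduct.tmul_zero N a)

lemma op_smul_tmul (s : S) (a : A) (n : N) :
    tmul S (MulOpposite.op s • a) n = tmul S a (s • n) :=
  (Submodule.Quotient.eq _).2 (Submodule.subset_span ⟨a, s, n, rfl⟩)

lemma smul_tmul (s : Sᵐᵒᵖ) (a : A) (n : N) :
    tmul S (s • a) n = tmul S a (s.unop • n) := op_smul_tmul s.unop a n

lemma sum_tmul {ι : Type*} (t : Finset ι) (f : ι → A) (n : N) :
    tmul S (∑ i ∈ t, f i) n = ∑ i ∈ t, tmul S (f i) n :=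
  map_sum (AddMonoidHom.mk' (fun a => tmul S a n) fun a a' => add_tmul a a' n) f t

lemma tmul_sum {ι : Type*} (t : Finset ι) (a : A) (f : ι → N) :
    tmul S a (∑ i ∈ t, f i) = ∑ i ∈ t, tmul S a (f i) :=
  map_sum (AddMonoidHom.mk' (fun n => tmul S a n) fun n n' => tmul_add a n n') f t

lemma induction {p : BalancedTensor S A N → Prop} (z : BalancedTensor S A N) (h0 : p 0)
    (ht : ∀ a n, p (tmul S a n)) (ha : ∀ x y, p x → p y → p (x + y)) : p z := by
  obtain ⟨z, rfl⟩ := (balancedRel S A N).mkQ_surjective z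
  induction z with
  | zero => rwa [map_zero]
  | tmul a n => exact ht a n
  | add x y hx hy => rw [map_add]; exact ha _ _ hx hy

lemma hom_ext {B : Type*} [AddCommGroup B] {f g : BalancedTensor S A N →+ B}
    (h : ∀ a n, f (tmul S a n) = g (tmul S a n)) : f = g := by
  ext z
  induction z using induction with
  | h0 => simp
  | ht a n => exact h a n
  | ha x y hx hy => rw [map_add, map_add, hx, hy]

/-- The homomorphism given by a balanced biadditive map. -/
noncomputable def lift {B : Type*} [AddCommGroup B] (f : A →+ N →+ B)
    (hf : ∀ a (s : S) n, f (MulOpposite.op s • a) n = f a (s • n)) :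
    BalancedTensor S A N →+ B :=
  ((balancedRel S A N).liftQ (TensorProduct.liftAddHom f (by
      intro c a n; simp)).toIntLinearMap (by
    rw [balancedRel, Submodule.span_le]
    rintro _ ⟨a, s, n, rfl⟩
    simp [hf])).toAddMonoidHom

/-- The map `A ⊗_S N → A' ⊗_S N'` given by `f : A → A'` and `g : N → N'`. -/
noncomputable def map (f : A →ₗ[Sᵐᵒᵖ] A') (g : N →ₗ[S] N') :
    BalancedTensor S A N →+ BalancedTensor S A' N' :=
  lift (AddMonoidHom.mk' (fun a => AddMonoidHom.mk' (fun n => tmul S (f a) (g n))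
    (fun n n' => by rw [map_add, tmul_add]))
    (fun a a' => by ext n; simp [add_tmul])) (fun a s n => by simp [op_smul_tmul])

@[simp]
lemma map_tmul (f : A →ₗ[Sᵐᵒᵖ] A') (g : N →ₗ[S] N') (a : A) (n : N) :
    map f g (tmul S a n) = tmul S (f a) (g n) := rfl

lemma map_map (f : A →ₗ[Sᵐᵒᵖ] A') (g : N →ₗ[S] N') (f' : A' →ₗ[Sᵐᵒᵖ] A'') (g' : N' →ₗ[S] N'')
    (z : BalancedTensor S A N) : map f' g' (map f g z) = map (f' ∘ₗ f) (g' ∘ₗ g) z := by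
  have : (map f' g').comp (map f g) = map (f' ∘ₗ f) (g' ∘ₗ g) := hom_ext fun a n => rfl
  exact DFunLike.congr_fun this z

lemma map_surjective {f : A →ₗ[Sᵐᵒᵖ] A'} {g : N →ₗ[S] N'} (hf : Function.Surjective f)
    (hg : Function.Surjective g) : Function.Surjective (map f g) := by
  intro z
  induction z using induction with
  | h0 => exact ⟨0, map_zero _⟩
  | ht a n =>
    obtain ⟨a, rfl⟩ := hf a
    obtain ⟨n, rfl⟩ := hg n
    exact ⟨tmul S a n, rfl⟩
  | ha x y hx hy =>
    obtain ⟨x, rfl⟩ := hx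
    obtain ⟨y, rfl⟩ := hy
    exact ⟨x + y, map_add _ _ _⟩

/-- Generating relations lift along surjections. This is what makes right exactness descend from `ℤ`
to `S`. -/
lemma exists_mem_balancedRel {f : A →ₗ[Sᵐᵒᵖ] A'} {g : N →ₗ[S] N'}
    (hf : Function.Surjective f) (hg : Function.Surjective g) (z : A' ⊗[ℤ] N')
    (hz : z ∈ balancedRel S A' N') : ∃ y ∈ balancedRel S A N,
      TensorProduct.map (f.restrictScalars ℤ) (g.restrictScalars ℤ) y = z := by
  have h : balancedRel S A' N' ≤ (balancedRel S A N).map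
      (TensorProduct.map (f.restrictScalars ℤ) (g.restrictScalars ℤ)) := by
    refine Submodule.span_le.2 ?_
    rintro _ ⟨a, s, n, rfl⟩
    obtain ⟨a, rfl⟩ := hf a
    obtain ⟨n, rfl⟩ := hg n
    exact ⟨_, Submodule.subset_span ⟨a, s, n, rfl⟩, by simp⟩
  exact h hz

lemma map_mkQ (f : A →ₗ[Sᵐᵒᵖ] A') (g : N →ₗ[S] N') (z : A ⊗[ℤ] N) :
    map f g ((balancedRel S A N).mkQ z) = (balancedRel S A' N').mkQ
      (TensorProduct.map (f.restrictScalars ℤ) (g.restrictScalars ℤ) z) := by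
  induction z with
  | zero => simp
  | tmul a n => rfl
  | add x y hx hy => rw [map_add, map_add, map_add, map_add, hx, hy]

lemma map_id_exact {g : N →ₗ[S] N'} {h : N' →ₗ[S] N''} (hgh : Function.Exact g h)
    (hh : Function.Surjective h) :
    Function.Exact (map (LinearMap.id : A →ₗ[Sᵐᵒᵖ] A) g) (map LinearMap.id h) := by
  intro z
  constructor
  · intro hz
    obtain ⟨z, rfl⟩ := (balancedRel S A N').mkQ_surjective z
    rw [map_mkQ, ← LinearMap.mem_ker, Submodule.ker_mkQ] at hz
    -- The image of `z` is a relation; subtracting a relation `y` lifting it puts `z - y` in the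
    -- kernel over `ℤ`, where right exactness is known.
    obtain ⟨y, hy, hyz⟩ := exists_mem_balancedRel (f := (LinearMap.id : A →ₗ[Sᵐᵒᵖ] A))
      Function.surjective_id hh _ hz
    have he : Function.Exact (g.restrictScalars ℤ) (h.restrictScalars ℤ) := hgh
    obtain ⟨x, hx⟩ := (lTensor_exact A he hh (z - y)).1 (by
      rw [map_sub, sub_eq_zero]; exact hyz.symm)
    refine ⟨(balancedRel S A N).mkQ x, ?_⟩
    have hx' : TensorProduct.map ((LinearMap.id : A →ₗ[Sᵐᵒᵖ] A).restrictScalars ℤ)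
      (g.restrictScalars ℤ) x = z - y := hx
    rw [map_mkQ, hx', map_sub, sub_eq_self]
    exact (Submodule.Quotient.mk_eq_zero _).2 hy
  · rintro ⟨z, rfl⟩
    rw [map_map, hgh.linearMap_comp_eq_zero]
    induction z using induction with
    | h0 => simp
    | ht a n => simp [tmul_zero]
    | ha x y hx hy => rw [map_add, hx, hy, add_zero]

lemma map_exact_id {f : A →ₗ[Sᵐᵒᵖ] A'} {h : A' →ₗ[Sᵐᵒᵖ] A''} (hfh : Function.Exact f h)
    (hh : Function.Surjective h) :
    Function.Exact (map f (LinearMap.id : N →ₗ[S] N)) (map h LinearMap.id) := by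
  intro z
  constructor
  · intro hz
    obtain ⟨z, rfl⟩ := (balancedRel S A' N).mkQ_surjective z
    rw [map_mkQ, ← LinearMap.mem_ker, Submodule.ker_mkQ] at hz
    obtain ⟨y, hy, hyz⟩ := exists_mem_balancedRel (g := (LinearMap.id : N →ₗ[S] N))
      hh Function.surjective_id _ hz
    have he : Function.Exact (f.restrictScalars ℤ) (h.restrictScalars ℤ) := hfh
    obtain ⟨x, hx⟩ := (rTensor_exact N he hh (z - y)).1 (by
      rw [map_sub, sub_eq_zero]; exact hyz.symm)
    refine ⟨(balancedRel S A N).mkQ x, ?_⟩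
    have hx' : TensorProduct.map (f.restrictScalars ℤ)
      ((LinearMap.id : N →ₗ[S] N).restrictScalars ℤ) x = z - y := hx
    rw [map_mkQ, hx', map_sub, sub_eq_self]
    exact (Submodule.Quotient.mk_eq_zero _).2 hy
  · rintro ⟨z, rfl⟩
    rw [map_map, hfh.linearMap_comp_eq_zero]
    induction z using induction with
    | h0 => simp
    | ht a n => simp [zero_tmul]
    | ha x y hx hy => rw [map_add, hx, hy, add_zero]

/-- A section `σ` of the canonical map from the free module on the set `N` gives coordinates `b ⊗ n
↦ (b · σ(n)ᵢ)ᵢ` on `B ⊗ N`. They are natural in `B`, and injective because `(bᵢ) ↦ ∑ bᵢ ⊗ i` is a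
left inverse, so injectivity can be checked coordinatewise. -/
lemma map_injective_of_projective_right [Module.Projective S N] {f : A →ₗ[Sᵐᵒᵖ] A'}
    (hf : Function.Injective f) : Function.Injective (map f (LinearMap.id : N →ₗ[S] N)) := by
  obtain ⟨σ, hσ⟩ := Module.projective_def'.1 (inferInstance : Module.Projective S N)
  have coords (B : Type u) [AddCommGroup B] [Module Sᵐᵒᵖ B] :
      ∃ c : BalancedTensor S B N →+ (N → B),
        (∀ b n i, c (tmul S b n) i = MulOpposite.op (σ n i) • b) ∧ Function.Injective c := by
    let c : BalancedTensor S B N →+ (N →₀ B) := lift (AddMonoidHom.mk' (fun b =>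
      AddMonoidHom.mk' (fun n => (σ n).mapRange (fun s => MulOpposite.op s • b) (by simp))
      (fun n n' => by ext i; simp [add_smul])) (fun b b' => by ext n i; simp [smul_add]))
      (fun b s n => by ext i; simp [mul_smul])
    have hc (b : B) (n i : N) : c (tmul S b n) i = MulOpposite.op (σ n i) • b := rfl
    let e : (N →₀ B) →+ BalancedTensor S B N := Finsupp.liftAddHom fun i =>
      AddMonoidHom.mk' (fun b => tmul S b i) fun b b' => add_tmul b b' i
    have he : e.comp c = AddMonoidHom.id _ := hom_ext fun b n => by
      have h1 : e (c (tmul S b n)) = (σ n).sum fun i s => tmul S (MulOpposite.op s • b) i :=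
        Finsupp.sum_mapRange_index (hf := by simp) (fun i => zero_tmul i)
      have h2 : (σ n).sum (fun i s => s • i) = n := DFunLike.congr_fun hσ n
      change e (c (tmul S b n)) = tmul S b n
      rw [h1]
      conv_rhs => rw [← h2]
      rw [Finsupp.sum, Finsupp.sum, tmul_sum]
      exact Finset.sum_congr rfl fun i _ => op_smul_tmul _ _ _
    refine ⟨Finsupp.coeFnAddHom.comp c, hc, ?_⟩
    exact fun x y hxy => Function.LeftInverse.injective (g := e) (f := c)
      (fun z => DFunLike.congr_fun he z) (DFunLike.coe_injective hxy)
  obtain ⟨c, hc, hci⟩ := coords A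
  obtain ⟨c', hc', -⟩ := coords A'
  have comm (z : BalancedTensor S A N) (i : N) : c' (map f LinearMap.id z) i = f (c z i) := by
    induction z using induction with
    | h0 => simp
    | ht a n => simp [hc, hc']
    | ha x y hx hy => simp [hx, hy]
  intro x y hxy
  exact hci (funext fun i => hf (by rw [← comm, ← comm, hxy]))

lemma map_injective_of_projective_left [Module.Projective Sᵐᵒᵖ A] {g : N →ₗ[S] N'}
    (hg : Function.Injective g) : Function.Injective (map (LinearMap.id : A →ₗ[Sᵐᵒᵖ] A) g) := by
  obtain ⟨σ, hσ⟩ := Module.projective_def'.1 (inferInstance : Module.Projective Sᵐᵒᵖ A)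
  have coords (B : Type u) [AddCommGroup B] [Module S B] :
      ∃ c : BalancedTensor S A B →+ (A → B),
        (∀ a b i, c (tmul S a b) i = (σ a i).unop • b) ∧ Function.Injective c := by
    let c : BalancedTensor S A B →+ (A →₀ B) := lift (AddMonoidHom.mk' (fun a =>
      AddMonoidHom.mk' (fun b => (σ a).mapRange (fun s => s.unop • b) (by simp))
      (fun n n' => by ext i; simp [smul_add])) (fun b b' => by ext n i; simp [add_smul]))
      (fun b s n => by ext i; simp [mul_smul])
    have hc (a : A) (b : B) (i : A) : c (tmul S a b) i = (σ a i).unop • b := rfl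
    let e : (A →₀ B) →+ BalancedTensor S A B := Finsupp.liftAddHom fun i =>
      AddMonoidHom.mk' (fun b => tmul S i b) fun b b' => tmul_add i b b'
    have he : e.comp c = AddMonoidHom.id _ := hom_ext fun a b => by
      have h1 : e (c (tmul S a b)) = (σ a).sum fun i s => tmul S i (s.unop • b) :=
        Finsupp.sum_mapRange_index (hf := by simp) (fun i => tmul_zero i)
      have h2 : (σ a).sum (fun i s => s • i) = a := DFunLike.congr_fun hσ a
      change e (c (tmul S a b)) = tmul S a b
      rw [h1]
      conv_rhs => rw [← h2]
      rw [Finsupp.sum, Finsupp.sum, sum_tmul]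
      exact Finset.sum_congr rfl fun i _ => (smul_tmul _ _ _).symm
    refine ⟨Finsupp.coeFnAddHom.comp c, hc, ?_⟩
    exact fun x y hxy => Function.LeftInverse.injective (g := e) (f := c)
      (fun z => DFunLike.congr_fun he z) (DFunLike.coe_injective hxy)
  obtain ⟨c, hc, hci⟩ := coords N
  obtain ⟨c', hc', -⟩ := coords N'
  have comm (z : BalancedTensor S A N) (i : A) : c' (map LinearMap.id g z) i = g (c z i) := by
    induction z using induction with
    | h0 => simp
    | ht a n => simp [hc, hc']
    | ha x y hx hy => simp [hx, hy]
  intro x y hxy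
  exact hci (funext fun i => hg (by rw [← comm, ← comm, hxy]))

/-- If `0 → A' → Q → A → 0` and `0 → N' → F → N → 0` are exact with `Q` projective and
`A' ⊗ N → Q ⊗ N` is injective, then `A ⊗ N' → A ⊗ F` is injective. -/
lemma map_injective_swap {Q F : Type u} [AddCommGroup Q] [Module Sᵐᵒᵖ Q] [AddCommGroup F]
    [Module S F] [Module.Projective Sᵐᵒᵖ Q]
    {i : A' →ₗ[Sᵐᵒᵖ] Q} {p : Q →ₗ[Sᵐᵒᵖ] A} (hip : Function.Exact i p)
    (hp : Function.Surjective p) {j : N' →ₗ[S] F} {q : F →ₗ[S] N} (hj : Function.Injective j)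
    (hjq : Function.Exact j q) (hq : Function.Surjective q)
    (h : Function.Injective (map i (LinearMap.id : N →ₗ[S] N))) :
    Function.Injective (map (LinearMap.id : A →ₗ[Sᵐᵒᵖ] A) j) := by
  rw [injective_iff_map_eq_zero]
  intro z hz
  -- Snake-type chase: lift the element to `Q ⊗ N'`. Its image in `Q ⊗ F` comes from some `v` in `A'
  -- ⊗ F`.
  obtain ⟨z, rfl⟩ := map_surjective (N := N') (g := LinearMap.id) hp Function.surjective_id z
  obtain ⟨v, hv⟩ := (map_exact_id (N := F) hip hp (map LinearMap.id j z)).1 (by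
    rw [map_map] at hz ⊢
    exact hz)
  -- The image of `v` in `Q ⊗ N` is that of an element of `Q ⊗ N'`, hence zero, and `A' ⊗ N → Q ⊗ N`
  -- is injective. So `v` comes from `A' ⊗ N'`.
  have hv' : map (LinearMap.id : A' →ₗ[Sᵐᵒᵖ] A') q v = 0 := by
    apply h
    rw [map_zero, map_map]
    have h1 : map LinearMap.id q (map (LinearMap.id : Q →ₗ[Sᵐᵒᵖ] Q) j z) = 0 :=
      (map_id_exact hjq hq _).2 ⟨z, rfl⟩
    rw [← hv, map_map] at h1
    exact h1
  obtain ⟨u, rfl⟩ := (map_id_exact hjq hq v).1 hv'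
  have hu : map i LinearMap.id u = z := by
    apply map_injective_of_projective_left (A := Q) hj
    rw [← hv, map_map, map_map]
    rfl
  rw [← hu]
  exact (map_exact_id (N := N') hip hp _).2 ⟨u, rfl⟩

/-- The composite `A' ⊗ N' → A' ⊗ F → Q ⊗ F` is injective and factors through `Q ⊗ N'`. Together
with `map_injective_swap` this is dimension shifting for `Tor`, trading a syzygy on the right for
one on the left. -/
lemma map_injective_syzygy {Q F : Type u} [AddCommGroup Q] [Module Sᵐᵒᵖ Q] [AddCommGroup F]
    [Module S F] [Module.Projective S F] {i : A' →ₗ[Sᵐᵒᵖ] Q} (hi : Function.Injective i)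
    {j : N' →ₗ[S] F} (h : Function.Injective (map (LinearMap.id : A' →ₗ[Sᵐᵒᵖ] A') j)) :
    Function.Injective (map i (LinearMap.id : N' →ₗ[S] N')) := by
  have h1 := (map_injective_of_projective_right (N := F) hi).comp h
  refine Function.Injective.of_comp (f := map (LinearMap.id : Q →ₗ[Sᵐᵒᵖ] Q) j) ?_
  refine Eq.mp (congrArg _ (funext fun z => ?_)) h1
  simp only [Function.comp_apply, map_map]
  rfl

end BalancedTensor
end BalancedTensor

/-! ### The duality map `A ⊗_S Hom_R(ω, E) → Hom_R(Hom_{S^op}(A, ω), E)`. -/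

section DualEval

variable {R S : Type u} [Ring R] [Ring S]
variable {ω : Type u} [AddCommGroup ω] [Module R ω] [Module Sᵐᵒᵖ ω] [SMulCommClass R Sᵐᵒᵖ ω]
  [SMulCommClass Sᵐᵒᵖ R ω]
variable {E : Type u} [AddCommGroup E] [Module R E]
variable {A A' Q Q' : Type u} [AddCommGroup A] [Module Sᵐᵒᵖ A] [AddCommGroup A'] [Module Sᵐᵒᵖ A']
  [AddCommGroup Q] [Module Sᵐᵒᵖ Q] [AddCommGroup Q'] [Module Sᵐᵒᵖ Q']

variable (R ω) in
/-- The `R`-linear map `Hom(A', ω) → Hom(A, ω)` given by `h : A → A'`. -/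
def precomp (h : A →ₗ[Sᵐᵒᵖ] A') : (A' →ₗ[Sᵐᵒᵖ] ω) →ₗ[R] (A →ₗ[Sᵐᵒᵖ] ω) where
  toFun g := g ∘ₗ h
  map_add' _ _ := rfl
  map_smul' _ _ := rfl

variable (R ω) in
/-- The `R`-linear map `Hom(A, ω) → ω` given by evaluation at `a`. -/
def applyAt (a : A) : (A →ₗ[Sᵐᵒᵖ] ω) →ₗ[R] ω where
  toFun g := g a
  map_add' _ _ := rfl
  map_smul' _ _ := rfl

variable (R ω E A) in
/-- The map `A ⊗_S Hom_R(ω, E) → Hom_R(Hom_{S^op}(A, ω), E)`, `a ⊗ f ↦ (g ↦ f (g a))`. -/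
noncomputable def dualEval :
    BalancedTensor S A (HomMod R S ω E) →+ ((A →ₗ[Sᵐᵒᵖ] ω) →ₗ[R] E) :=
  BalancedTensor.lift (AddMonoidHom.mk' (fun a => AddMonoidHom.mk'
    (fun f => (HomMod.toLin ω f).comp (applyAt R ω a))
    (fun _ _ => rfl)) (fun a a' => by
      ext f g
      exact (congrArg (HomMod.toLin ω f) (map_add g a a')).trans (map_add _ _ _)))
    (fun a s f => by
      ext g
      exact congrArg (HomMod.toLin ω f) (map_smul g _ a))

lemma dualEval_map (h : A →ₗ[Sᵐᵒᵖ] A') (z : BalancedTensor S A (HomMod R S ω E)) :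
    dualEval R ω E A' (BalancedTensor.map h LinearMap.id z) =
      (dualEval R ω E A z) ∘ₗ precomp R ω h := by
  induction z using BalancedTensor.induction with
  | h0 => simp
  | ht a n => rfl
  | ha x y hx hy => rw [map_add, map_add, hx, hy, map_add, LinearMap.add_comp]

lemma dualEval_bijective_of_projective [Module.Finite Sᵐᵒᵖ Q] [Module.Projective Sᵐᵒᵖ Q] :
    Function.Bijective (dualEval R ω E Q (S := S)) := by
  obtain ⟨n, p, σ, -, -, hσ⟩ := Module.Finite.exists_comp_eq_id_of_projective Sᵐᵒᵖ Q
  -- The `q i` and the coordinates of `σ` form a dual basis of `Q`. The inverse map sends `φ` to `∑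
  -- qᵢ ⊗ (φ ∘ rᵢ)`, where `rᵢ x` is `z ↦ σ(z)ᵢ · x`.
  let q (i : Fin n) : Q := p (Pi.single i 1)
  have hq (x : Q) : ∑ i, σ x i • q i = x := by
    have h := DFunLike.congr_fun hσ x
    conv_rhs => rw [← LinearMap.id_apply (R := Sᵐᵒᵖ) x, ← h]
    simp only [q, ← map_smul, ← map_sum, LinearMap.comp_apply]
    congr 1
    ext j
    simp [Finset.sum_apply, Pi.single_apply]
  let r (i : Fin n) : ω →ₗ[R] (Q →ₗ[Sᵐᵒᵖ] ω) :=
    { toFun := fun x => (LinearMap.toSpanSingleton Sᵐᵒᵖ ω x) ∘ₗ (LinearMap.proj i) ∘ₗ σ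
      map_add' := fun x y => by ext z; simp
      map_smul' := fun c x => by
        ext z
        simpa using smul_comm (σ z i) c x }
  have hr (i : Fin n) (x : ω) (z : Q) : r i x z = σ z i • x := rfl
  let c (φ : (Q →ₗ[Sᵐᵒᵖ] ω) →ₗ[R] E) (i : Fin n) : HomMod R S ω E := φ.comp (r i)
  let e : ((Q →ₗ[Sᵐᵒᵖ] ω) →ₗ[R] E) → BalancedTensor S Q (HomMod R S ω E) := fun φ =>
    ∑ i, BalancedTensor.tmul S (q i) (c φ i)
  have he (φ ψ) : e (φ + ψ) = e φ + e ψ := by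
    rw [← Finset.sum_add_distrib]
    exact Finset.sum_congr rfl fun i _ => BalancedTensor.tmul_add (q i) (c φ i) (c ψ i)
  have h1 (φ) : dualEval R ω E Q (e φ) = φ := by
    ext g
    simp only [e, map_sum, LinearMap.sum_apply]
    change ∑ i, φ (r i (g (q i))) = φ g
    rw [← map_sum]
    congr 1
    ext z
    simp only [LinearMap.sum_apply, hr, ← map_smul, ← map_sum, hq]
  have h2 : (AddMonoidHom.mk' e he).comp (dualEval R ω E Q) = AddMonoidHom.id _ :=
    BalancedTensor.hom_ext fun a f => by
      change e _ = BalancedTensor.tmul S a f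
      conv_rhs => rw [← hq a, BalancedTensor.sum_tmul]
      refine Finset.sum_congr rfl fun i _ => ?_
      rw [BalancedTensor.smul_tmul]
      rfl
  exact ⟨Function.LeftInverse.injective (g := e) fun z => DFunLike.congr_fun h2 z,
    fun φ => ⟨e φ, h1 φ⟩⟩

lemma exists_comp_eq_of_surjective {B : Type*} [AddCommGroup B] [Module Sᵐᵒᵖ B]
    {f : Q' →ₗ[Sᵐᵒᵖ] Q} {p : Q →ₗ[Sᵐᵒᵖ] A} (hfp : Function.Exact f p)
    (hp : Function.Surjective p) (g : Q →ₗ[Sᵐᵒᵖ] B) (hg : g ∘ₗ f = 0) :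
    ∃ g' : A →ₗ[Sᵐᵒᵖ] B, g' ∘ₗ p = g := by
  refine ⟨((LinearMap.ker p).liftQ g fun x hx => ?_) ∘ₗ
    (p.quotKerEquivOfSurjective hp).symm.toLinearMap, ?_⟩
  · obtain ⟨y, rfl⟩ := (hfp x).1 hx
    exact DFunLike.congr_fun hg y
  · ext x
    have : (p.quotKerEquivOfSurjective hp).symm (p x) = (LinearMap.ker p).mkQ x :=
      (LinearEquiv.symm_apply_eq _).2 rfl
    simp [this]

-- Since `Hom(A, ω) → Hom(Q, ω) → Hom(Q', ω)` is exact, `φ` factors through the image of the second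
-- map, a submodule of `Hom(Q', ω)`, and then extends because `E` is injective.
omit [SMulCommClass R Sᵐᵒᵖ ω] in
lemma exists_extend_of_precomp [Module.Injective R E]
    {f : Q' →ₗ[Sᵐᵒᵖ] Q} {p : Q →ₗ[Sᵐᵒᵖ] A} (hfp : Function.Exact f p)
    (hp : Function.Surjective p) (φ : (Q →ₗ[Sᵐᵒᵖ] ω) →ₗ[R] E) (hφ : φ ∘ₗ precomp R ω p = 0) :
    ∃ ψ : (Q' →ₗ[Sᵐᵒᵖ] ω) →ₗ[R] E, ψ ∘ₗ precomp R ω f = φ := by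
  obtain ⟨ψ, hψ⟩ := Module.Injective.out
    ((LinearMap.ker (precomp R ω f)).liftQ (precomp R ω f) le_rfl)
    (LinearMap.ker_eq_bot.1 (Submodule.ker_liftQ_eq_bot _ _ _ le_rfl))
    ((LinearMap.ker (precomp R ω f)).liftQ φ fun g hg => by
      obtain ⟨g', rfl⟩ := exists_comp_eq_of_surjective hfp hp g hg
      exact DFunLike.congr_fun hφ g')
  exact ⟨ψ, LinearMap.ext fun g => hψ ((LinearMap.ker (precomp R ω f)).mkQ g)⟩

omit [SMulCommClass R Sᵐᵒᵖ ω] in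
lemma precomp_injective {p : Q →ₗ[Sᵐᵒᵖ] A} (hp : Function.Surjective p) :
    Function.Injective (precomp R ω p) := fun g g' h =>
  LinearMap.ext fun x => by
    obtain ⟨x, rfl⟩ := hp x
    exact DFunLike.congr_fun h x

/-- The map `A ⊗_S Hom_R(ω, E) → Hom_R(Hom_{S^op}(A, ω), E)` is bijective when `A` is finitely
presented and `E` is injective. -/
lemma dualEval_bijective [Module.Injective R E] [Module.Finite Sᵐᵒᵖ Q] [Module.Projective Sᵐᵒᵖ Q]
    [Module.Finite Sᵐᵒᵖ Q'] [Module.Projective Sᵐᵒᵖ Q']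
    {f : Q' →ₗ[Sᵐᵒᵖ] Q} {p : Q →ₗ[Sᵐᵒᵖ] A} (hfp : Function.Exact f p)
    (hp : Function.Surjective p) : Function.Bijective (dualEval R ω E A (S := S)) := by
  have hQ := dualEval_bijective_of_projective (R := R) (S := S) (ω := ω) (E := E) (Q := Q)
  have hQ' := dualEval_bijective_of_projective (R := R) (S := S) (ω := ω) (E := E) (Q := Q')
  constructor
  · rw [injective_iff_map_eq_zero]
    intro z hz
    obtain ⟨z, rfl⟩ := BalancedTensor.map_surjective (N := HomMod R S ω E) (g := LinearMap.id) hp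
      Function.surjective_id z
    rw [dualEval_map] at hz
    -- Both sides are right exact in the presentation `Q' → Q → A`, so an element killed by duality
    -- for `A` comes from `Q'` by the projective case.
    obtain ⟨ψ, hψ⟩ := exists_extend_of_precomp hfp hp _ hz
    obtain ⟨y, rfl⟩ := hQ'.2 ψ
    rw [← dualEval_map] at hψ
    rw [← hQ.1 hψ]
    exact (BalancedTensor.map_exact_id hfp hp _).2 ⟨y, rfl⟩
  · intro φ
    obtain ⟨ψ, hψ⟩ := Module.Injective.out (precomp R ω p) (precomp_injective hp) φ
    obtain ⟨z, rfl⟩ := hQ.2 ψ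
    exact ⟨BalancedTensor.map p LinearMap.id z, by
      rw [dualEval_map]
      exact LinearMap.ext hψ⟩

/-- If every map `A' → ω` extends to `Q`, then `A' ⊗_S Hom_R(ω, E) → Q ⊗_S Hom_R(ω, E)` is
injective. -/
lemma map_homMod_injective {i : A' →ₗ[Sᵐᵒᵖ] Q}
    (hA' : Function.Injective (dualEval R ω E A' (S := S)))
    (hi : ∀ f : A' →ₗ[Sᵐᵒᵖ] ω, ∃ g : Q →ₗ[Sᵐᵒᵖ] ω, g ∘ₗ i = f) :
    Function.Injective
      (BalancedTensor.map i (LinearMap.id : HomMod R S ω E →ₗ[S] HomMod R S ω E)) := by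
  rw [injective_iff_map_eq_zero]
  intro z hz
  apply hA'
  rw [map_zero]
  ext f
  -- The value of the dual of `z` at `g ∘ i` is that of its image in `Q ⊗ Hom_R(ω, E)` at `g`, which
  -- is zero.
  obtain ⟨g, rfl⟩ := hi f
  have h := dualEval_map (R := R) i z
  rw [hz, map_zero] at h
  exact (DFunLike.congr_fun h g).symm

end DualEval

/-! ### Transfer from `BalancedTensor` to `TensorMod`, and evaluation as a duality map. -/

section Comparison

variable (R : Type u) {S : Type u} [Ring R] [Ring S]
variable {ω : Type u} [AddCommGroup ω] [Module R ω] [Module Sᵐᵒᵖ ω] [SMulCommClass R Sᵐᵒᵖ ω]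
variable {N N' : Type u} [AddCommGroup N] [Module S N] [AddCommGroup N'] [Module S N']

/-- The commuting actions make the set of generators `R`-stable, so its additive span is already an
`R`-submodule. -/
lemma mem_tensorRel_iff (z : ω ⊗[ℤ] N) : z ∈ tensorRel R S ω N ↔ z ∈ balancedRel S ω N := by
  constructor
  · intro hz
    induction hz using Submodule.span_induction with
    | mem x hx => exact Submodule.subset_span hx
    | zero => exact zero_mem _
    | add x y _ _ hx hy => exact add_mem hx hy
    | smul r x h hx =>
      clear h
      induction hx using Submodule.span_induction with
      | mem x hx =>
        obtain ⟨x, s, n, rfl⟩ := hx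
        refine Submodule.subset_span ⟨r • x, s, n, ?_⟩
        rw [smul_sub, TensorProduct.smul_tmul', TensorProduct.smul_tmul', smul_comm]
      | zero => rw [smul_zero]; exact zero_mem _
      | add x y _ _ hx hy => rw [smul_add]; exact add_mem hx hy
      | smul c x _ hx =>
        have : r • c • x = c • r • x := smul_comm r c x
        exact this ▸ Submodule.smul_mem _ c hx
  · intro hz
    induction hz using Submodule.span_induction with
    | mem x hx => exact Submodule.subset_span hx
    | zero => exact zero_mem _
    | add x y _ _ hx hy => exact add_mem hx hy
    | smul c x _ hx => exact zsmul_mem hx c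

variable (S ω N) in
/-- The isomorphism between the two constructions of `ω ⊗_S N`. -/
noncomputable def tensorModEquiv : BalancedTensor S ω N ≃+ TensorMod R S ω N :=
  QuotientAddGroup.quotientAddEquivOfEq (M := (balancedRel S ω N).toAddSubgroup)
    (N := (tensorRel R S ω N).toAddSubgroup)
    (by ext z; exact (mem_tensorRel_iff R z).symm)

lemma tensorModEquiv_map (g : N →ₗ[S] N') (z : BalancedTensor S ω N) :
    tensorModEquiv R S ω N' (BalancedTensor.map LinearMap.id g z) =
      TensorMod.map ω g (tensorModEquiv R S ω N z) := by
  induction z using BalancedTensor.induction with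
  | h0 => simp
  | ht a n => rfl
  | ha x y hx hy => rw [map_add, map_add, hx, hy, map_add, map_add]

lemma tensorModMap_injective_iff (g : N →ₗ[S] N') :
    Function.Injective (TensorMod.map (R := R) ω g) ↔
      Function.Injective (BalancedTensor.map (LinearMap.id : ω →ₗ[Sᵐᵒᵖ] ω) g) := by
  have h : (tensorModEquiv R S ω N') ∘ (BalancedTensor.map (LinearMap.id : ω →ₗ[Sᵐᵒᵖ] ω) g) =
      TensorMod.map ω g ∘ (tensorModEquiv R S ω N) := funext fun z => tensorModEquiv_map R g z
  rw [← EquivLike.comp_injective _ (tensorModEquiv R S ω N'), h, EquivLike.injective_comp]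

lemma tensorModMap_exact {N'' : Type u} [AddCommGroup N''] [Module S N'']
    {g : N →ₗ[S] N'} {h : N' →ₗ[S] N''} (hgh : Function.Exact g h) (hh : Function.Surjective h) :
    Function.Exact (TensorMod.map (R := R) ω g) (TensorMod.map ω h) := by
  intro z
  obtain ⟨z, rfl⟩ := (tensorModEquiv R S ω N').surjective z
  rw [← tensorModEquiv_map, EmbeddingLike.map_eq_zero_iff,
    BalancedTensor.map_id_exact hgh hh z]
  constructor
  · rintro ⟨y, rfl⟩
    exact ⟨tensorModEquiv R S ω N y, (tensorModEquiv_map R g y).symm⟩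
  · rintro ⟨y, hy⟩
    obtain ⟨y, rfl⟩ := (tensorModEquiv R S ω N).surjective y
    rw [← tensorModEquiv_map] at hy
    exact ⟨y, (tensorModEquiv R S ω N').injective hy⟩

lemma tensorModMap_surjective {g : N →ₗ[S] N'} (hg : Function.Surjective g) :
    Function.Surjective (TensorMod.map (R := R) ω g) := by
  intro z
  obtain ⟨z, rfl⟩ := (tensorModEquiv R S ω N').surjective z
  obtain ⟨y, rfl⟩ := BalancedTensor.map_surjective (f := LinearMap.id (R := Sᵐᵒᵖ) (M := ω))
    Function.surjective_id hg z
  exact ⟨tensorModEquiv R S ω N y, (tensorModEquiv_map R g y).symm⟩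

lemma eval_tensorModEquiv [SMulCommClass Sᵐᵒᵖ R ω] {E : Type u} [AddCommGroup E] [Module R E]
    (z : BalancedTensor S ω (HomMod R S ω E)) :
    TensorMod.eval ω E (tensorModEquiv R S ω _ z) = dualEval R ω E ω z LinearMap.id := by
  induction z using BalancedTensor.induction with
  | h0 => simp
  | ht a n => rfl
  | ha x y hx hy => rw [map_add, map_add, hx, hy, map_add, LinearMap.add_apply]

/-- Evaluation is duality for `A = ω` followed by evaluation at the identity of `ω`. The homothety
isomorphism `R ≅ Hom_{S^op}(ω, ω)` turns the latter into `Hom_R(R, E) ≅ E`. -/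
lemma eval_bijective [SMulCommClass Sᵐᵒᵖ R ω] {E : Type u} [AddCommGroup E] [Module R E]
    (hω : Function.Bijective (leftHomothety R S ω))
    (h : Function.Bijective (dualEval R ω E ω (S := S))) :
    Function.Bijective (TensorMod.eval (R := R) (S := S) ω E) := by
  have h1 : Function.Bijective
      (fun φ : (ω →ₗ[Sᵐᵒᵖ] ω) →ₗ[R] E => φ LinearMap.id) := by
    have hs (r : R) : leftHomothety R S ω r = r • LinearMap.id := rfl
    constructor
    · intro φ ψ hφ
      ext g
      obtain ⟨r, rfl⟩ := hω.2 g
      rw [hs, map_smul, map_smul]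
      exact congrArg (r • ·) hφ
    · intro x
      let e : R ≃ₗ[R] (ω →ₗ[Sᵐᵒᵖ] ω) := LinearEquiv.ofBijective
        (LinearMap.toSpanSingleton R _ LinearMap.id) hω
      refine ⟨LinearMap.toSpanSingleton R E x ∘ₗ e.symm.toLinearMap, ?_⟩
      have : e.symm LinearMap.id = 1 := (LinearEquiv.symm_apply_eq _).2 (one_smul R _).symm
      simp [this]
  have h2 : TensorMod.eval (R := R) (S := S) ω E ∘ tensorModEquiv R S ω _ =
      (fun φ : (ω →ₗ[Sᵐᵒᵖ] ω) →ₗ[R] E => φ LinearMap.id) ∘ dualEval R ω E ω :=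
    funext fun z => eval_tensorModEquiv R z
  rw [← EquivLike.bijective_comp (tensorModEquiv R S ω _), h2]
  exact h1.comp h

end Comparison

/-! ### Syzygies of a projective resolution and dimension shifting for `Ext`. -/

section Syzygy
open Limits

variable {S : Type u} [Ring S] {M : ModuleCat.{u} S} (P : ProjectiveResolution M)

/-- The syzygies of a projective resolution. -/
noncomputable def syz : ℕ → ModuleCat.{u} S
  | 0 => M
  | k + 1 => ModuleCat.of S (LinearMap.range (P.complex.d (k + 1) k).hom)

/-- The inclusion of a syzygy in the resolution. -/
noncomputable def syzι (k : ℕ) : syz P (k + 1) ⟶ P.complex.X k :=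
  ModuleCat.ofHom (LinearMap.range (P.complex.d (k + 1) k).hom).subtype

/-- The projection from the resolution onto a syzygy. -/
noncomputable def syzπ : ∀ k : ℕ, P.complex.X k ⟶ syz P k
  | 0 => P.π.f 0
  | k + 1 => ModuleCat.ofHom (P.complex.d (k + 1) k).hom.rangeRestrict

lemma syzι_injective (k : ℕ) : Function.Injective (syzι P k) := Subtype.val_injective

lemma syzπ_surjective : ∀ k : ℕ, Function.Surjective (syzπ P k)
  | 0 => (ModuleCat.epi_iff_surjective _).1 (inferInstanceAs (Epi (P.π.f 0)))
  | k + 1 => (P.complex.d (k + 1) k).hom.surjective_rangeRestrict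

lemma syzπ_syzι (k : ℕ) : syzπ P (k + 1) ≫ syzι P k = P.complex.d (k + 1) k := rfl

lemma d_syzπ_exact : ∀ k : ℕ, Function.Exact (P.complex.d (k + 1) k) (syzπ P k)
  | 0 => (ShortComplex.ShortExact.moduleCat_exact_iff_function_exact _).1 P.exact₀
  | k + 1 => by
    have h := (ShortComplex.ShortExact.moduleCat_exact_iff_function_exact _).1 (P.exact_succ k)
    intro x
    rw [← map_eq_zero_iff (syzι P k).hom (syzι_injective P k)]
    exact h x

lemma syzι_syzπ_exact (k : ℕ) : Function.Exact (syzι P k) (syzπ P k) := by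
  intro x
  rw [d_syzπ_exact P k x]
  constructor
  · rintro ⟨y, rfl⟩
    exact ⟨syzπ P (k + 1) y, rfl⟩
  · rintro ⟨y, rfl⟩
    obtain ⟨y, rfl⟩ := syzπ_surjective P (k + 1) y
    exact ⟨y, rfl⟩

/-- The short exact sequences relating consecutive syzygies. -/
noncomputable def syzShortComplex (k : ℕ) : ShortComplex (ModuleCat.{u} S) :=
  ShortComplex.mk (syzι P k) (syzπ P k) (by
    ext x
    exact (syzι_syzπ_exact P k _).2 ⟨x, rfl⟩)

lemma syzShortComplex_shortExact (k : ℕ) : (syzShortComplex P k).ShortExact where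
  exact := (ShortComplex.ShortExact.moduleCat_exact_iff_function_exact _).2 (syzι_syzπ_exact P k)
  mono_f := (ModuleCat.mono_iff_injective _).2 (syzι_injective P k)
  epi_g := (ModuleCat.epi_iff_surjective _).2 (syzπ_surjective P k)

lemma subsingleton_ext_syz {W : ModuleCat.{u} S}
    (h : ∀ n : ℕ, 1 ≤ n → Subsingleton (Abelian.Ext M W n)) (k n : ℕ) (hn : 1 ≤ n) :
    Subsingleton (Abelian.Ext (syz P k) W n) := by
  induction k generalizing n with
  | zero => exact h n hn
  | succ k ih =>
    refine ⟨fun x y => ?_⟩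
    suffices ∀ x : Abelian.Ext (syz P (k + 1)) W n, x = 0 by rw [this x, this y]
    intro x
    -- The connecting map sends `x` into `Ext` of degree `1 + n` of the previous syzygy, which
    -- vanishes. So `x` comes from `Ext` of the projective term in positive degree, which also
    -- vanishes.
    have := ih (1 + n) (by lia)
    obtain ⟨x₂, hx₂⟩ := Abelian.Ext.contravariant_sequence_exact₁
      (syzShortComplex_shortExact P k) W x (n₁ := 1 + n) rfl
      (Subsingleton.elim (α := Abelian.Ext (syz P k) W (1 + n)) _ _)
    obtain ⟨n, rfl⟩ : ∃ m, n = m + 1 := ⟨n - 1, by lia⟩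
    have : x₂ = 0 := Abelian.Ext.eq_zero_of_projective (P := P.complex.X k) x₂
    rw [← hx₂, this, Abelian.Ext.comp_zero]
    rfl

/-- The obstruction to the extension lies in `Ext¹` of the `k`-th syzygy. -/
lemma exists_extend_syz {W : ModuleCat.{u} S}
    (h : ∀ n : ℕ, 1 ≤ n → Subsingleton (Abelian.Ext M W n)) (k : ℕ) (f : syz P (k + 1) ⟶ W) :
    ∃ g : P.complex.X k ⟶ W, syzι P k ≫ g = f := by
  have := subsingleton_ext_syz P h k 1 le_rfl
  obtain ⟨x₂, hx₂⟩ := Abelian.Ext.contravariant_sequence_exact₁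
    (syzShortComplex_shortExact P k) W (Abelian.Ext.mk₀ f) (n₁ := 1) rfl
    (Subsingleton.elim (α := Abelian.Ext (syz P k) W 1) _ _)
  obtain ⟨g, rfl⟩ := Abelian.Ext.addEquiv₀.symm.surjective x₂
  refine ⟨g, (Abelian.Ext.mk₀_bijective _ _).1 ?_⟩
  exact (Abelian.Ext.mk₀_comp_mk₀ _ _).symm.trans hx₂

end Syzygy

/-! ### Injective modules are Bass modules. -/

section Injective
open Limits

variable {R S : Type u} [Ring R] [Ring S]
variable {ω : Type u} [AddCommGroup ω] [Module R ω] [Module Sᵐᵒᵖ ω] [SMulCommClass R Sᵐᵒᵖ ω]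

/-- Each differential factors as a projection onto a syzygy followed by its inclusion. If the
inclusions stay injective after tensoring, right exactness gives exactness of the tensored
resolution in positive degrees. -/
lemma isZero_leftDerived_of_injective {X : ModuleCat.{u} S} (P : ProjectiveResolution X)
    (h : ∀ j, Function.Injective (TensorMod.map (R := R) ω (syzι P j).hom)) (n : ℕ) (hn : 1 ≤ n) :
    IsZero (((tensorFunctor R S ω).leftDerived n).obj X) := by
  obtain ⟨n, rfl⟩ : ∃ m, n = m + 1 := ⟨n - 1, by lia⟩
  refine IsZero.of_iso ?_ (P.isoLeftDerivedObj (tensorFunctor R S ω) (n + 1))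
  refine HomologicalComplex.ExactAt.isZero_homology ?_
  rw [HomologicalComplex.exactAt_iff' _ (n + 2) (n + 1) n (by simp) (by simp),
    ShortComplex.ShortExact.moduleCat_exact_iff_function_exact]
  have h1 := tensorModMap_exact R (ω := ω) (d_syzπ_exact P (n + 1)) (syzπ_surjective P (n + 1))
  have h2 : (tensorFunctor R S ω).map (P.complex.d (n + 1) n) =
      (tensorFunctor R S ω).map (syzπ P (n + 1)) ≫ (tensorFunctor R S ω).map (syzι P n) := by
    rw [← Functor.map_comp, syzπ_syzι]
  intro x
  refine (congrArg (· = 0) (ConcreteCategory.congr_hom h2 x)).to_iff.trans ?_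
  exact (map_eq_zero_iff _ (h n)).trans (h1 x)

/-- Injective modules belong to the Bass class. -/
theorem isBass_of_injective (hω : IsSemidualizing R S ω) (E : ModuleCat.{u} R) [Injective E] :
    IsBass R S ω E := by
  have : SMulCommClass Sᵐᵒᵖ R ω := SMulCommClass.symm _ _ _
  have : Module.Injective R E := Module.injective_module_of_injective_object R E
  obtain ⟨Q, hQ⟩ := hω.right_resolution
  have hQ' (k : ℕ) : Module.Projective Sᵐᵒᵖ (Q.complex.X k) :=
    (IsProjective.iff_projective _).2 (Q.projective k)
  have hd (k : ℕ) : Function.Bijective (dualEval R ω E (syz Q k) (S := S)) :=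
    dualEval_bijective (d_syzπ_exact Q k) (syzπ_surjective Q k)
  let P := projectiveResolution ((homFunctor R S ω).obj E)
  have hP (k : ℕ) : Module.Projective S (P.complex.X k) :=
    (IsProjective.iff_projective _).2 (P.projective k)
  -- In terms of `Tor`, this is `Tor₁(Ωᵏω, ΩʲN) = 0` for `N = Hom_R(ω, E)`. For `j = 0` it follows
  -- from duality and the extension of maps `Ωᵏ⁺¹ω → ω`; the case `(j + 1, k)` reduces to `(j, k +
  -- 1)`.
  have key (j k : ℕ) : Function.Injective
      (BalancedTensor.map (syzι Q k).hom (LinearMap.id : syz P j →ₗ[S] syz P j)) := by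
    induction j generalizing k with
    | zero =>
      refine map_homMod_injective (hd (k + 1)).1 fun f => ?_
      obtain ⟨g, hg⟩ := exists_extend_syz Q hω.right_ext k (ModuleCat.ofHom f)
      exact ⟨g.hom, congrArg ModuleCat.Hom.hom hg⟩
    | succ j ih =>
      exact BalancedTensor.map_injective_syzygy (syzι_injective Q k)
        (BalancedTensor.map_injective_swap (syzι_syzπ_exact Q (k + 1)) (syzπ_surjective Q (k + 1))
          (syzι_injective P j) (syzι_syzπ_exact P j) (syzπ_surjective P j) (ih (k + 1)))
  -- The case `k = 0` of `key`, read on the resolution of `N` instead of that of `ω`.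
  have key' (j : ℕ) : Function.Injective (TensorMod.map (R := R) ω (syzι P j).hom) := by
    rw [tensorModMap_injective_iff]
    exact BalancedTensor.map_injective_swap (syzι_syzπ_exact Q 0) (syzπ_surjective Q 0)
      (syzι_injective P j) (syzι_syzπ_exact P j) (syzπ_surjective P j) (key j 0)
  refine ⟨fun n hn => ?_, isZero_leftDerived_of_injective P key', ?_⟩
  · obtain ⟨n, rfl⟩ : ∃ m, n = m + 1 := ⟨n - 1, by lia⟩
    exact Abelian.Ext.subsingleton_of_injective _ _ n
  · rw [ConcreteCategory.isIso_iff_bijective]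
    exact eval_bijective R hω.left_homothety (hd 0)

end Injective

/-! ### Modules without higher `Tor`, as complexes in a single degree. -/

section TorAcyclic
open Limits Pretriangulated

variable (R S : Type u) [Ring R] [Ring S]
variable (ω : Type u) [AddCommGroup ω] [Module R ω] [Module Sᵐᵒᵖ ω]

/-- The modules `N` such that `Tor_n^S(ω, N) = 0` for `n ≥ 1`. -/
def TorAcyclic (N : ModuleCat.{u} S) : Prop :=
  ∀ n : ℕ, 1 ≤ n → IsZero (((tensorFunctor R S ω).leftDerived n).obj N)

/-- The functor `ω ⊗_S -` on complexes. -/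
noncomputable abbrev cTensor : CochainComplex (ModuleCat.{u} S) ℤ ⥤
    CochainComplex (ModuleCat.{u} R) ℤ :=
  (tensorFunctor R S ω).mapHomologicalComplex (ComplexShape.up ℤ)

variable {R S ω}

lemma TorAcyclic.of_iso {N N' : ModuleCat.{u} S} (h : TorAcyclic R S ω N) (e : N ≅ N') :
    TorAcyclic R S ω N' :=
  fun n hn => (h n hn).of_iso (((tensorFunctor R S ω).leftDerived n).mapIso e.symm)

lemma TorAcyclic.of_isZero {N : ModuleCat.{u} S} (h : IsZero N) : TorAcyclic R S ω N :=
  fun n hn => by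
    obtain ⟨n, rfl⟩ : ∃ m, n = m + 1 := ⟨n - 1, by lia⟩
    have := h.projective
    exact (tensorFunctor R S ω).isZero_leftDerived_obj_projective_succ n N

lemma isZero_leftDerived_iff {X : ModuleCat.{u} S} (P : ProjectiveResolution X) (n : ℕ) :
    IsZero (((tensorFunctor R S ω).leftDerived (n + 1)).obj X) ↔
      ((cTensor R S ω).obj P.cochainComplex).ExactAt (-((n : ℤ) + 1)) := by
  rw [(P.isoLeftDerivedObj (tensorFunctor R S ω) (n + 1)).isZero_iff]
  refine (HomologicalComplex.exactAt_iff_isZero_homology _ _).symm.trans ?_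
  rw [HomologicalComplex.exactAt_iff' _ (n + 2) (n + 1) n (by simp) (by simp),
    HomologicalComplex.exactAt_iff' _ (-((n : ℤ) + 2)) (-((n : ℤ) + 1)) (-n) (by simp; lia)
      (by simp)]
  refine ShortComplex.exact_iff_of_iso (Iso.symm (ShortComplex.isoMk
    ((tensorFunctor R S ω).mapIso (P.cochainComplexXIso _ (n + 2)))
    ((tensorFunctor R S ω).mapIso (P.cochainComplexXIso _ (n + 1)))
    ((tensorFunctor R S ω).mapIso (P.cochainComplexXIso _ n)) ?_ ?_))
  · change (tensorFunctor R S ω).map _ ≫ (tensorFunctor R S ω).map _ =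
      (tensorFunctor R S ω).map _ ≫ (tensorFunctor R S ω).map _
    rw [← Functor.map_comp, ← Functor.map_comp,
      P.cochainComplex_d _ _ (n + 2) (n + 1)]
    simp
  · change (tensorFunctor R S ω).map _ ≫ (tensorFunctor R S ω).map _ =
      (tensorFunctor R S ω).map _ ≫ (tensorFunctor R S ω).map _
    rw [← Functor.map_comp, ← Functor.map_comp,
      P.cochainComplex_d _ _ (n + 1) n]
    simp

/-- The nonzero term of a complex concentrated in one degree. -/
noncomputable def singleXIso (X : ModuleCat.{u} S) (n : ℤ) :
    X ≅ ((CochainComplex.singleFunctor (ModuleCat.{u} S) n).obj X).X n :=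
  (HomologicalComplex.singleObjXSelf (.up ℤ) n X).symm

lemma π'_f_zero_eq {X : ModuleCat.{u} S} (P : ProjectiveResolution X) :
    P.π'.f 0 = (P.cochainComplexXIso 0 0).hom ≫ syzπ P 0 ≫ (singleXIso X 0).hom :=
  P.π'_f_zero

lemma π'_f_zero_surjective {X : ModuleCat.{u} S} (P : ProjectiveResolution X) :
    Function.Surjective (P.π'.f 0) := by
  rw [π'_f_zero_eq]
  exact (((ConcreteCategory.bijective_of_isIso (singleXIso X 0).hom).2).comp
    (syzπ_surjective P 0)).comp
    (ConcreteCategory.bijective_of_isIso (P.cochainComplexXIso 0 0).hom).2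

lemma cochainComplex_exact_zero {X : ModuleCat.{u} S} (P : ProjectiveResolution X) :
    Function.Exact (P.cochainComplex.d (-1) 0) (P.π'.f 0) := by
  rw [π'_f_zero_eq, P.cochainComplex_d (-1) 0 1 0]
  have h₁ := ConcreteCategory.bijective_of_isIso (P.cochainComplexXIso (-1) 1).hom
  have h₀ := ConcreteCategory.bijective_of_isIso (P.cochainComplexXIso 0 0).hom
  intro x
  refine (map_eq_zero_iff _ (ConcreteCategory.bijective_of_isIso (singleXIso X 0).hom).1).trans
    ((d_syzπ_exact P 0 _).trans ⟨?_, ?_⟩)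
  · rintro ⟨y, hy⟩
    obtain ⟨y, rfl⟩ := h₁.2 y
    refine ⟨y, h₀.1 (Eq.trans ?_ hy)⟩
    exact ConcreteCategory.congr_hom (Iso.inv_hom_id (P.cochainComplexXIso 0 0)) _
  · rintro ⟨y, rfl⟩
    refine ⟨(P.cochainComplexXIso (-1) 1).hom y, ?_⟩
    exact (ConcreteCategory.congr_hom (Iso.inv_hom_id (P.cochainComplexXIso 0 0)) _).symm

lemma isZero_single_X (X : ModuleCat.{u} S) (n i : ℤ) (hi : i ≠ n) :
    IsZero (((CochainComplex.singleFunctor _ n).obj X).X i) :=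
  HomologicalComplex.isZero_single_obj_X _ _ _ _ hi

lemma eq_of_isZero {X : ModuleCat.{u} S} (h : IsZero X) (x y : X) : x = y := by
  have := ModuleCat.subsingleton_of_isZero h
  exact Subsingleton.elim _ _

variable [SMulCommClass R Sᵐᵒᵖ ω]

lemma quasiIso_cTensor_resolution {X : ModuleCat.{u} S} (P : ProjectiveResolution X)
    (hX : TorAcyclic R S ω X) : QuasiIso ((cTensor R S ω).map P.π') := by
  have h0 (i : ℤ) (hi : i ≠ 0) :
      IsZero (((cTensor R S ω).obj ((CochainComplex.singleFunctor _ 0).obj X)).X i) :=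
    (tensorFunctor R S ω).map_isZero (isZero_single_X X 0 i hi)
  refine quasiIso_of_isTriv _ ⟨fun n => ?_, fun n x hx hpx => ?_⟩
  · by_cases hn : n = 0
    · subst hn
      refine tensorModMap_surjective R (g := (P.π'.f 0).hom) (π'_f_zero_surjective P)
    · exact fun y => ⟨0, eq_of_isZero (h0 n hn) _ _⟩
  -- The cocycle lies in degree `n + 1`: below zero exactness is the vanishing of `Tor`, at zero it
  -- is right exactness of the tensor product, and above zero the resolution vanishes.
  · rcases lt_trichotomy n (-1) with hn | rfl | hn
    · obtain ⟨m, hm⟩ : ∃ m : ℕ, n + 1 = -((m : ℤ) + 1) := ⟨(-n - 2).toNat, by lia⟩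
      have h := (isZero_leftDerived_iff P m).1 (hX (m + 1) (by lia))
      rw [← hm, HomologicalComplex.exactAt_iff' _ n (n + 1) (n + 1 + 1) (by simp) (by simp)] at h
      obtain ⟨y, hy⟩ := (ShortComplex.moduleCat_exact_iff _).1 h x hx
      exact ⟨y, hy, eq_of_isZero (h0 n (by lia)) _ _⟩
    · obtain ⟨y, hy⟩ := (tensorModMap_exact R (ω := ω) (g := (P.cochainComplex.d (-1) 0).hom)
        (h := (P.π'.f 0).hom) (cochainComplex_exact_zero P) (π'_f_zero_surjective P) x).1 hpx
      exact ⟨y, hy, eq_of_isZero (h0 (-1) (by lia)) _ _⟩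
    · have : IsZero (((cTensor R S ω).obj P.cochainComplex).X (n + 1)) :=
        (tensorFunctor R S ω).map_isZero (CochainComplex.isZero_of_isStrictlyLE _ 0 _ (by lia))
      exact ⟨0, eq_of_isZero this _ _, map_zero _⟩

variable [HasDerivedCategory.{w} (ModuleCat.{u} R)] [HasDerivedCategory.{w'} (ModuleCat.{u} S)]

lemma isIso_Qh_map_iff {K L : CochainComplex (ModuleCat.{u} S) ℤ} (f : K ⟶ L) :
    IsIso (DerivedCategory.Qh.map ((HomotopyCategory.quotient _ _).map f)) ↔ QuasiIso f := by
  rw [← DerivedCategory.isIso_Q_map_iff_quasiIso]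
  exact (NatIso.isIso_map_iff (DerivedCategory.quotientCompQhIso (ModuleCat.{u} S)) f)

omit [SMulCommClass R Sᵐᵒᵖ ω] in
lemma tensorAcyclic_iff_quasiIso {K L : CochainComplex (ModuleCat.{u} S) ℤ} (f : K ⟶ L)
    [QuasiIso f] (hK : tensorAcyclic R S ω ((HomotopyCategory.quotient _ _).obj K)) :
    tensorAcyclic R S ω ((HomotopyCategory.quotient _ _).obj L) ↔
      QuasiIso ((cTensor R S ω).map f) := by
  have := (isIso_Qh_map_iff f).2 inferInstance
  exact (tensorAcyclic_iff ((HomotopyCategory.quotient _ _).map f) hK).trans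
    (isIso_Qh_map_iff ((cTensor R S ω).map f))

omit [SMulCommClass R Sᵐᵒᵖ ω] in
lemma tensorAcyclic_resolution {X : ModuleCat.{u} S} (P : ProjectiveResolution X) :
    tensorAcyclic R S ω ((HomotopyCategory.quotient _ _).obj P.cochainComplex) := by
  have := CochainComplex.isKProjective_of_projective P.cochainComplex 0
  exact tensorAcyclic_of_leftOrthogonal R ω _
    ((CochainComplex.isKProjective_iff_leftOrthogonal _).1 inferInstance)

/-- In degree zero, a projective resolution is K-projective and remains a quasi-isomorphism after
tensoring; shifting gives the other degrees. -/
lemma tensorAcyclic_single (X : ModuleCat.{u} S) (hX : TorAcyclic R S ω X) (n : ℤ) :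
    tensorAcyclic R S ω
      ((HomotopyCategory.quotient _ _).obj ((CochainComplex.singleFunctor _ n).obj X)) := by
  have h := (tensorAcyclic_iff_quasiIso (projectiveResolution X).π'
    (tensorAcyclic_resolution _)).2 (quasiIso_cTensor_resolution _ hX)
  rw [← tensorAcyclic_shift_iff _ n]
  exact ((tensorAcyclic R S ω).prop_iff_of_iso
    (((HomotopyCategory.singleFunctors _).shiftIso n 0 n (by lia)).app X)).2 h

end TorAcyclic

/-! ### Brutal truncations and bounded complexes of modules without higher `Tor`. -/

section BrutalTruncation
open Limits Pretriangulated

variable {S : Type u} [Ring S] (K : CochainComplex (ModuleCat.{u} S) ℤ) (n : ℤ)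

/-- The degree `i` part of the brutal truncation in degrees `≥ n`. -/
def brutal (i : ℤ) : Submodule S (K.X i) where
  carrier := {x | i < n → x = 0}
  add_mem' hx hy hi := by rw [hx hi, hy hi, add_zero]
  zero_mem' _ := rfl
  smul_mem' c x hx hi := by rw [hx hi, smul_zero]

lemma d_mem_brutal (i j : ℤ) (x : K.X i) (hx : x ∈ brutal K n i) : K.d i j x ∈ brutal K n j := by
  intro hj
  by_cases h : i + 1 = j
  · rw [hx (by lia), map_zero]
  · rw [K.shape i j h]
    rfl

/-- The brutal truncation in degrees `≥ n`. -/
noncomputable def brutalGE : CochainComplex (ModuleCat.{u} S) ℤ where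
  X i := ModuleCat.of S (brutal K n i)
  d i j := ModuleCat.ofHom ((K.d i j).hom.restrict (d_mem_brutal K n i j))
  shape i j h := ModuleCat.hom_ext (LinearMap.ext fun x => Subtype.ext
    (ConcreteCategory.congr_hom (K.shape i j h) x.1))
  d_comp_d' i j k _ _ := ModuleCat.hom_ext (LinearMap.ext fun x => Subtype.ext
    (d_d_apply K i j k x.1))

/-- The brutal truncation in degrees `< n`. -/
noncomputable def brutalLT : CochainComplex (ModuleCat.{u} S) ℤ where
  X i := ModuleCat.of S (K.X i ⧸ brutal K n i)
  d i j := ModuleCat.ofHom (Submodule.mapQ _ _ (K.d i j).hom (d_mem_brutal K n i j))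
  shape i j h := by
    ext x
    exact congrArg (Submodule.mkQ (brutal K n j)) (ConcreteCategory.congr_hom (K.shape i j h) x)
  d_comp_d' i j k _ _ := by
    ext x
    exact congrArg (Submodule.mkQ (brutal K n k)) (d_d_apply K i j k x)

/-- The inclusion of the brutal truncation. -/
noncomputable def brutalι : brutalGE K n ⟶ K where
  f i := ModuleCat.ofHom (brutal K n i).subtype
  comm' _ _ _ := rfl

/-- The projection onto the brutal truncation. -/
noncomputable def brutalπ : K ⟶ brutalLT K n where
  f i := ModuleCat.ofHom (brutal K n i).mkQ
  comm' _ _ _ := rfl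

/-- The short exact sequence of brutal truncations. -/
noncomputable def brutalShortComplex : ShortComplex (CochainComplex (ModuleCat.{u} S) ℤ) :=
  ShortComplex.mk (brutalι K n) (brutalπ K n) (by
    ext i x
    exact (Submodule.Quotient.mk_eq_zero _).2 x.2)

variable {n} in
lemma isZero_brutalGE_X (i : ℤ) (hi : i < n) : IsZero ((brutalGE K n).X i) := by
  have : Subsingleton (brutal K n i) := ⟨fun x y => Subtype.ext ((x.2 hi).trans (y.2 hi).symm)⟩
  exact ModuleCat.isZero_of_subsingleton (ModuleCat.of S (brutal K n i))

variable {n} in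
lemma isZero_brutalLT_X (i : ℤ) (hi : n ≤ i) : IsZero ((brutalLT K n).X i) := by
  have h : brutal K n i = ⊤ := (Submodule.eq_top_iff').2 fun x hi' => absurd hi' (by lia)
  have : Subsingleton (K.X i ⧸ brutal K n i) := Submodule.Quotient.subsingleton_iff.2 h
  exact ModuleCat.isZero_of_subsingleton (ModuleCat.of S (K.X i ⧸ brutal K n i))

variable {n} in
lemma isIso_brutalι_f (i : ℤ) (hi : n ≤ i) : IsIso ((brutalι K n).f i) := by
  rw [ConcreteCategory.isIso_iff_bijective]
  exact ⟨Subtype.val_injective, fun x => ⟨⟨x, fun hi' => absurd hi' (by lia)⟩, rfl⟩⟩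

variable {n} in
lemma isIso_brutalπ_f (i : ℤ) (hi : i < n) : IsIso ((brutalπ K n).f i) := by
  rw [ConcreteCategory.isIso_iff_bijective]
  refine ⟨(injective_iff_map_eq_zero (brutal K n i).mkQ).2 fun x hx => ?_,
    Submodule.mkQ_surjective _⟩
  exact (Submodule.Quotient.mk_eq_zero _).1 hx hi

instance : (brutalGE K n).IsStrictlyGE n :=
  (CochainComplex.isStrictlyGE_iff _ _).2 fun i hi => isZero_brutalGE_X K i hi

/-- The sequence of brutal truncations is degreewise split. -/
noncomputable def brutalSplitting (i : ℤ) :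
    ((brutalShortComplex K n).map (HomologicalComplex.eval _ _ i)).Splitting := by
  by_cases hi : i < n
  · exact ShortComplex.Splitting.ofIsZeroOfIsIso _ (isZero_brutalGE_X K i hi)
      (isIso_brutalπ_f K i hi)
  · exact ShortComplex.Splitting.ofIsIsoOfIsZero _ (isIso_brutalι_f K i (by lia))
      (isZero_brutalLT_X K i (by lia))

variable {R : Type u} [Ring R]
variable {ω : Type u} [AddCommGroup ω] [Module R ω] [Module Sᵐᵒᵖ ω] [SMulCommClass R Sᵐᵒᵖ ω]
variable [HasDerivedCategory.{w} (ModuleCat.{u} R)] [HasDerivedCategory.{w'} (ModuleCat.{u} S)]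

-- A degreewise split exact sequence of complexes gives a distinguished triangle in the homotopy
-- category, so two-out-of-three applies to the truncations.
omit [SMulCommClass R Sᵐᵒᵖ ω] in
lemma tensorAcyclic_brutal
    (h : tensorAcyclic R S ω ((HomotopyCategory.quotient _ _).obj (brutalLT K n))) :
    tensorAcyclic R S ω ((HomotopyCategory.quotient _ _).obj (brutalGE K n)) ↔
      tensorAcyclic R S ω ((HomotopyCategory.quotient _ _).obj K) := by
  have h' := tensorAcyclic_two_of_three (R := R) (ω := ω) _
    ((HomotopyCategory.distinguished_iff_iso_trianglehOfDegreewiseSplit _).2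
      ⟨_, brutalSplitting K n, ⟨Iso.refl _⟩⟩)
  exact ⟨fun h₁ => h'.2.1 h₁ h, fun h₂ => h'.2.2 h₂ h⟩

/-- Bounded complexes of modules without higher `Tor` compute the derived tensor product. -/
lemma tensorAcyclic_of_bounded (hK : ∀ i, TorAcyclic R S ω (K.X i)) (a b : ℤ)
    [K.IsStrictlyGE a] [K.IsStrictlyLE b] :
    tensorAcyclic R S ω ((HomotopyCategory.quotient _ _).obj K) := by
  -- Induction on the width: the lowest term, in degree `a`, is split off at each step, and width
  -- zero forces the complex to vanish.
  obtain ⟨m, hm⟩ : ∃ m : ℕ, b < a + m := ⟨(b - a + 1).toNat, by lia⟩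
  induction m generalizing a K with
  | zero =>
    refine tensorAcyclic_of_isZero _ (Functor.map_isZero _ ?_)
    rw [IsZero.iff_id_eq_zero]
    ext i : 1
    by_cases hi : i < a
    · exact (K.isZero_of_isStrictlyGE a i hi).eq_of_src _ _
    · exact (K.isZero_of_isStrictlyLE b i (by lia)).eq_of_src _ _
  | succ m ih =>
    have hGE (i : ℤ) (hi : i ≤ a) : (brutalLT K (a + 1)).X i ≅ K.X i := by
      have := isIso_brutalπ_f K (n := a + 1) i (by lia)
      exact (asIso ((brutalπ K (a + 1)).f i)).symm
    have : (brutalLT K (a + 1)).IsStrictlyGE a := (CochainComplex.isStrictlyGE_iff _ _).2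
      fun i hi => (K.isZero_of_isStrictlyGE a i hi).of_iso (hGE i hi.le)
    have : (brutalLT K (a + 1)).IsStrictlyLE a := (CochainComplex.isStrictlyLE_iff _ _).2
      fun i hi => isZero_brutalLT_X K i (by lia)
    have hX (i : ℤ) (hi : a + 1 ≤ i) : (brutalGE K (a + 1)).X i ≅ K.X i := by
      have := isIso_brutalι_f K (n := a + 1) i hi
      exact asIso ((brutalι K (a + 1)).f i)
    have : (brutalGE K (a + 1)).IsStrictlyLE b := by
      refine (CochainComplex.isStrictlyLE_iff _ _).2 fun i hi => ?_
      by_cases hi' : a + 1 ≤ i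
      · exact (K.isZero_of_isStrictlyLE b i hi).of_iso (hX i hi')
      · exact isZero_brutalGE_X K i (by lia)
    refine (tensorAcyclic_brutal K (a + 1) ?_).1
      (ih (brutalGE K (a + 1)) (fun i => ?_) (a + 1) (by lia))
    · obtain ⟨X, ⟨e⟩⟩ := (brutalLT K (a + 1)).exists_iso_single a
      refine ((tensorAcyclic R S ω).prop_iff_of_iso ((HomotopyCategory.quotient _ _).mapIso e)).2
        (tensorAcyclic_single X (TorAcyclic.of_iso (hK a) ?_) a)
      exact (hGE a le_rfl).symm ≪≫ (HomologicalComplex.eval _ _ a).mapIso e ≪≫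
        (singleXIso X a).symm
    · by_cases hi : a + 1 ≤ i
      · exact (hK i).of_iso (hX i hi).symm
      · exact TorAcyclic.of_isZero (isZero_brutalGE_X K i (by lia))

end BrutalTruncation

/-! ### Cocycles and vanishing of `Ext` by dimension shifting. -/

section Cycles
open Limits

variable {R : Type u} [Ring R] (K : CochainComplex (ModuleCat.{u} R) ℤ)

/-- The cocycles of a complex of modules. -/
def cyc (i : ℤ) : ModuleCat.{u} R := ModuleCat.of R (LinearMap.ker (K.d i (i + 1)).hom)

/-- The inclusion of the cocycles. -/
def cycι (i : ℤ) : cyc K i ⟶ K.X i :=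
  ModuleCat.ofHom (LinearMap.ker (K.d i (i + 1)).hom).subtype

/-- The differential, as a map to the cocycles. -/
def cycπ (i : ℤ) : K.X i ⟶ cyc K (i + 1) :=
  ModuleCat.ofHom ((K.d i (i + 1)).hom.codRestrict _ fun x => d_d_apply K i (i + 1) (i + 1 + 1) x)

lemma cycι_injective (i : ℤ) : Function.Injective (cycι K i) := Subtype.val_injective

lemma cycι_cycπ_exact (i : ℤ) : Function.Exact (cycι K i) (cycπ K i) := by
  intro x
  refine ⟨fun h => ⟨⟨x, congrArg Subtype.val h⟩, rfl⟩, ?_⟩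
  rintro ⟨y, rfl⟩
  exact Subtype.ext y.2

lemma exactAt_iff_cycπ_surjective (i : ℤ) :
    K.ExactAt (i + 1) ↔ Function.Surjective (cycπ K i) := by
  rw [K.exactAt_iff' i (i + 1) (i + 1 + 1) (by simp) (by simp), ShortComplex.moduleCat_exact_iff]
  refine ⟨fun h x => ?_, fun h x hx => ?_⟩
  · obtain ⟨y, hy⟩ := h x.1 x.2
    exact ⟨y, Subtype.ext hy⟩
  · obtain ⟨y, hy⟩ := h ⟨x, hx⟩
    exact ⟨y, congrArg Subtype.val hy⟩

/-- The short complexes relating consecutive cocycles. -/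
def cycShortComplex (i : ℤ) : ShortComplex (ModuleCat.{u} R) :=
  ShortComplex.mk (cycι K i) (cycπ K i) (by
    ext x
    exact (cycι_cycπ_exact K i _).2 ⟨x, rfl⟩)

variable {K} in
lemma cycShortComplex_shortExact {i : ℤ} (h : K.ExactAt (i + 1)) :
    (cycShortComplex K i).ShortExact where
  exact := (ShortComplex.ShortExact.moduleCat_exact_iff_function_exact _).2 (cycι_cycπ_exact K i)
  mono_f := (ModuleCat.mono_iff_injective _).2 (cycι_injective K i)
  epi_g := (ModuleCat.epi_iff_surjective _).2 ((exactAt_iff_cycπ_surjective K i).1 h)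

/-- The modules `X` such that `Ext^n(W, X) = 0` for `n ≥ 1`. -/
def ExtAcyclic (W X : ModuleCat.{u} R) : Prop :=
  ∀ n : ℕ, 1 ≤ n → Subsingleton (Abelian.Ext W X n)

variable {W : ModuleCat.{u} R}

/-- The hypothesis on the maps says that `Z` is a retract of `X ⊕ Y`. This is the form in which the
identity of a mapping cone term decomposes. -/
lemma ExtAcyclic.of_retracts {X Y Z : ModuleCat.{u} R} (hX : ExtAcyclic W X) (hY : ExtAcyclic W Y)
    (a : Z ⟶ X) (b : X ⟶ Z) (c : Z ⟶ Y) (d : Y ⟶ Z) (h : a ≫ b + c ≫ d = 𝟙 Z) :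
    ExtAcyclic W Z := by
  intro n hn
  have := hX n hn
  have := hY n hn
  suffices ∀ x : Abelian.Ext W Z n, x = 0 from ⟨fun x y => by rw [this x, this y]⟩
  intro x
  rw [← x.comp_mk₀_id, ← h, Abelian.Ext.mk₀_add, Abelian.Ext.comp_add,
    ← Abelian.Ext.mk₀_comp_mk₀, ← Abelian.Ext.mk₀_comp_mk₀,
    ← Abelian.Ext.comp_assoc_of_third_deg_zero, ← Abelian.Ext.comp_assoc_of_third_deg_zero,
    Subsingleton.elim (x.comp (Abelian.Ext.mk₀ a) (add_zero n)) 0,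
    Subsingleton.elim (x.comp (Abelian.Ext.mk₀ c) (add_zero n)) 0,
    Abelian.Ext.zero_comp, Abelian.Ext.zero_comp, add_zero]

lemma ExtAcyclic.of_iso {X Z : ModuleCat.{u} R} (hX : ExtAcyclic W X) (e : X ≅ Z) :
    ExtAcyclic W Z :=
  hX.of_retracts hX e.inv e.hom 0 0 (by simp)

lemma ExtAcyclic.of_isZero {X : ModuleCat.{u} R} (h : IsZero X) : ExtAcyclic W X := by
  intro n hn
  obtain ⟨n, rfl⟩ : ∃ m, n = m + 1 := ⟨n - 1, by lia⟩
  have := h.injective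
  exact Abelian.Ext.subsingleton_of_injective _ _ n

lemma ExtAcyclic.of_injective {X : ModuleCat.{u} R} [Injective X] : ExtAcyclic W X := by
  intro n hn
  obtain ⟨n, rfl⟩ : ∃ m, n = m + 1 := ⟨n - 1, by lia⟩
  exact Abelian.Ext.subsingleton_of_injective _ _ n

lemma ExtAcyclic.of_shortExact {T : ShortComplex (ModuleCat.{u} R)} (hT : T.ShortExact)
    (h₁ : ExtAcyclic W T.X₁) (h₂ : ExtAcyclic W T.X₂) : ExtAcyclic W T.X₃ := by
  intro n hn
  have := h₁ (n + 1) (by lia)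
  have := h₂ n hn
  suffices ∀ x : Abelian.Ext W T.X₃ n, x = 0 from ⟨fun x y => by rw [this x, this y]⟩
  intro x
  obtain ⟨y, rfl⟩ := Abelian.Ext.covariant_sequence_exact₃ W hT x rfl (Subsingleton.elim _ _)
  rw [Subsingleton.elim y 0, Abelian.Ext.zero_comp]

/-- Lifting of morphisms along an epimorphism whose kernel has no `Ext`. -/
lemma exists_lift_of_shortExact {T : ShortComplex (ModuleCat.{u} R)} (hT : T.ShortExact)
    (h₁ : ExtAcyclic W T.X₁) (f : W ⟶ T.X₃) : ∃ g : W ⟶ T.X₂, g ≫ T.g = f := by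
  have := h₁ 1 le_rfl
  obtain ⟨y, hy⟩ := Abelian.Ext.covariant_sequence_exact₃ W hT (Abelian.Ext.mk₀ f) (n₁ := 1) rfl
    (Subsingleton.elim _ _)
  obtain ⟨g, rfl⟩ := Abelian.Ext.addEquiv₀.symm.surjective y
  exact ⟨g, (Abelian.Ext.mk₀_bijective _ _).1 ((Abelian.Ext.mk₀_comp_mk₀ _ _).symm.trans hy)⟩

variable {K}

/-- In an acyclic bounded below complex of modules without `Ext`, the cocycles have no `Ext`. -/
lemma extAcyclic_cyc_of_acyclic (hK : K.Acyclic) (a : ℤ) [K.IsStrictlyGE a]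
    (h : ∀ i, ExtAcyclic W (K.X i)) (i : ℤ) : ExtAcyclic W (cyc K i) := by
  have h0 (i : ℤ) (hi : i < a) : ExtAcyclic W (cyc K i) := by
    refine ExtAcyclic.of_isZero ?_
    have := ModuleCat.subsingleton_of_isZero (K.isZero_of_isStrictlyGE a i hi)
    have : Subsingleton (cyc K i) := (cycι_injective K i).subsingleton
    exact ModuleCat.isZero_of_subsingleton _
  obtain ⟨m, hm⟩ : ∃ m : ℕ, i < a + m := ⟨(i - a + 1).toNat, by lia⟩
  induction m generalizing i with
  | zero => exact h0 i (by lia)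
  | succ m ih =>
    obtain ⟨j, rfl⟩ : ∃ j, i = j + 1 := ⟨i - 1, by lia⟩
    exact (ih j (by lia)).of_shortExact (cycShortComplex_shortExact (hK (j + 1))) (h j)

/-- Dimension shifting along a right resolution which stays exact after applying `Hom(W, -)`. -/
lemma extAcyclic_cyc_of_lift (n : ℤ) (hK : ∀ i, n ≤ i → K.ExactAt (i + 1))
    (h : ∀ i, ExtAcyclic W (K.X i))
    (hl : ∀ i, n ≤ i → ∀ f : W ⟶ cyc K (i + 1), ∃ g : W ⟶ K.X i, g ≫ cycπ K i = f)
    (i : ℤ) (hi : n ≤ i) : ExtAcyclic W (cyc K i) := by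
  intro m hm
  obtain ⟨m, rfl⟩ : ∃ k, m = k + 1 := ⟨m - 1, by lia⟩
  have hS (i : ℤ) (hi : n ≤ i) := cycShortComplex_shortExact (hK i hi)
  induction m generalizing i with
  | zero =>
    suffices ∀ x : Abelian.Ext W (cyc K i) 1, x = 0 from ⟨fun x y => by rw [this x, this y]⟩
    intro x
    -- As `Ext¹(W, Kⁱ) = 0`, the class `x` is the connecting image of a map from `W` to the next
    -- cocycles. That map lifts to `Kⁱ`, so its connecting image is zero.
    have := h i 1 le_rfl
    obtain ⟨y, rfl⟩ := Abelian.Ext.covariant_sequence_exact₁ W (hS i hi) x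
      (Subsingleton.elim (α := Abelian.Ext W (K.X i) 1) _ _) (n₀ := 0) rfl
    obtain ⟨f, rfl⟩ := (Abelian.Ext.mk₀_bijective _ _).2 y
    obtain ⟨g, rfl⟩ : ∃ g : W ⟶ (cycShortComplex K i).X₂, g ≫ (cycShortComplex K i).g = f :=
      hl i hi f
    rw [← Abelian.Ext.mk₀_comp_mk₀, Abelian.Ext.comp_assoc_of_second_deg_zero,
      ShortComplex.ShortExact.comp_extClass, Abelian.Ext.comp_zero]
    rfl
  | succ m ih =>
    suffices ∀ x : Abelian.Ext W (cyc K i) (m + 1 + 1), x = 0 from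
      ⟨fun x y => by rw [this x, this y]⟩
    intro x
    have := h i (m + 1 + 1) (by lia)
    have := ih (i + 1) (by lia) (by lia)
    obtain ⟨y, rfl⟩ := Abelian.Ext.covariant_sequence_exact₁ W (hS i hi) x
      (Subsingleton.elim (α := Abelian.Ext W (K.X i) (m + 1 + 1)) _ _) (n₀ := m + 1) rfl
    rw [Subsingleton.elim (α := Abelian.Ext W (cyc K (i + 1)) (m + 1)) y 0]
    exact Abelian.Ext.zero_comp ..

end Cycles

/-! ### Exactness of `Hom_R(ω, -)` on complexes. -/

section HomComplex
open Limits

variable (R S : Type u) [Ring R] [Ring S]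
variable (ω : Type u) [AddCommGroup ω] [Module R ω] [Module Sᵐᵒᵖ ω] [SMulCommClass R Sᵐᵒᵖ ω]

/-- The functor `Hom_R(ω, -)` on complexes. -/
noncomputable abbrev cHom : CochainComplex (ModuleCat.{u} R) ℤ ⥤
    CochainComplex (ModuleCat.{u} S) ℤ :=
  (homFunctor R S ω).mapHomologicalComplex (ComplexShape.up ℤ)

variable {R S ω}
variable {K : CochainComplex (ModuleCat.{u} R) ℤ}

/-- Cocycles of `Hom_R(ω, K)` in degree `i + 1` are maps from `ω` to the cocycles of `K`, and
coboundaries are those that lift to `Kⁱ`. -/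
lemma exactAt_cHom_iff (i : ℤ) : ((cHom R S ω).obj K).ExactAt (i + 1) ↔
    ∀ f : ModuleCat.of R ω ⟶ cyc K (i + 1),
      ∃ g : ModuleCat.of R ω ⟶ K.X i, g ≫ cycπ K i = f := by
  rw [HomologicalComplex.exactAt_iff' _ i (i + 1) (i + 1 + 1) (by simp) (by simp),
    ShortComplex.moduleCat_exact_iff]
  refine ⟨fun h f => ?_, fun h x hx => ?_⟩
  · obtain ⟨g, hg⟩ := h (f ≫ cycι K (i + 1)).hom
      (LinearMap.ext fun x => (f x).2)
    refine ⟨ModuleCat.ofHom g, ModuleCat.hom_ext (LinearMap.ext fun x => Subtype.ext ?_)⟩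
    exact LinearMap.congr_fun hg x
  · obtain ⟨g, hg⟩ := h (ModuleCat.ofHom (LinearMap.codRestrict _ x
      fun y => LinearMap.congr_fun hx y))
    exact ⟨g.hom, congrArg (fun φ => (φ ≫ cycι K (i + 1)).hom) hg⟩

lemma acyclic_cHom (hK : K.Acyclic) (a : ℤ) [K.IsStrictlyGE a]
    (h : ∀ i, ExtAcyclic (ModuleCat.of R ω) (K.X i)) : ((cHom R S ω).obj K).Acyclic := by
  intro i
  obtain ⟨i, rfl⟩ : ∃ j, i = j + 1 := ⟨i - 1, by lia⟩
  rw [exactAt_cHom_iff]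
  exact exists_lift_of_shortExact (cycShortComplex_shortExact (hK (i + 1)))
    (extAcyclic_cyc_of_acyclic hK a h i)

lemma quasiIso_iff_acyclic_mappingCone {L : CochainComplex (ModuleCat.{u} R) ℤ} (f : K ⟶ L) :
    QuasiIso f ↔ (CochainComplex.mappingCone f).Acyclic := by
  refine (HomotopyCategory.quotient_map_mem_quasiIso_iff f).symm.trans ?_
  rw [HomotopyCategory.quasiIso_eq_trW_subcategoryAcyclic]
  exact ((HomotopyCategory.subcategoryAcyclic (ModuleCat.{u} R)).trW_iff_of_distinguished _
      (HomotopyCategory.mappingCone_triangleh_distinguished f)).trans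
    (HomotopyCategory.quotient_obj_mem_subcategoryAcyclic_iff_acyclic _)

/-- `Hom_R(ω, -)` preserves quasi-isomorphisms between bounded below complexes of modules
without `Ext`. -/
lemma quasiIso_cHom_map {L : CochainComplex (ModuleCat.{u} R) ℤ} (f : K ⟶ L) [QuasiIso f] (a : ℤ)
    [K.IsStrictlyGE a] [L.IsStrictlyGE a] (hK : ∀ i, ExtAcyclic (ModuleCat.of R ω) (K.X i))
    (hL : ∀ i, ExtAcyclic (ModuleCat.of R ω) (L.X i)) : QuasiIso ((cHom R S ω).map f) := by
  have := CochainComplex.isStrictlyGE_mappingCone f a a (a - 1)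
  -- The mapping cone starts one degree below `K` and `L`, whence `a - 1`. Its terms inherit
  -- `Ext`-vanishing from those of `K` and `L`.
  have h := acyclic_cHom (S := S) ((quasiIso_iff_acyclic_mappingCone f).1 inferInstance) (a - 1)
    fun i => (hK (i + 1)).of_retracts (hL i) _ _ _ _
      (CochainComplex.mappingCone.id_X f i (i + 1) rfl)
  rw [quasiIso_iff_acyclic_mappingCone]
  exact fun i => (h i).of_iso
    (CochainComplex.mappingCone.mapHomologicalComplexIso f (homFunctor R S ω))

end HomComplex

/-! ### The Bass class of complexes in terms of explicit representatives. -/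

section BassComplex
open Limits

variable {R S : Type u} [Ring R] [Ring S]
variable {ω : Type u} [AddCommGroup ω] [Module R ω] [Module Sᵐᵒᵖ ω] [SMulCommClass R Sᵐᵒᵖ ω]
variable [HasDerivedCategory.{w} (ModuleCat.{u} R)] [HasDerivedCategory.{w'} (ModuleCat.{u} S)]

/-- A bounded below complex of modules without `Ext` computes `RHom_R(ω, -)`. -/
lemma isIso_rHomUnit (K : CochainComplex.Plus (ModuleCat.{u} R))
    (h : ∀ i, ExtAcyclic (ModuleCat.of R ω) (K.obj.X i)) :
    IsIso ((rHomUnit R S ω).app ((HomotopyCategory.Plus.quotient _).obj K)) := by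
  obtain ⟨a, ha⟩ := K.property
  obtain ⟨I, hI, j, hj⟩ := CochainComplex.Plus.exists_quasiIso_injective K a
  let J := (InjectiveObject.ι (ModuleCat.{u} R)).mapCochainComplexPlus.obj I
  have hJ : IsIso ((rHomUnit R S ω).app ((HomotopyCategory.Plus.quotient _).obj J)) := by
    unfold rHomUnit rHom
    infer_instance
  have : J.obj.IsStrictlyGE a :=
    (CochainComplex.isStrictlyGE_mapHomologicalComplex_obj_iff _ (InjectiveObject.ι _) a).2 hI
  have (i : ℤ) : Injective (J.obj.X i) :=
    inferInstanceAs (Injective ((InjectiveObject.ι _).obj (I.obj.X i)))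
  have hj' : QuasiIso j.hom := hj
  -- Comparison with an injective resolution `j`, where the unit is invertible: `Hom_R(ω, j)` is
  -- still a quasi-isomorphism, so naturality transports invertibility back to `K`.
  have h1 : IsIso (((homFunctor R S ω).mapHomotopyCategoryPlus ⋙ DerivedCategory.Plus.Qh).map
      ((HomotopyCategory.Plus.quotient _).map j)) := by
    refine (isIso_iff_of_reflects_iso _ DerivedCategory.Plus.ι).1 ?_
    exact (isIso_Qh_map_iff ((cHom R S ω).map j.hom)).2
      (quasiIso_cHom_map j.hom a h fun i => ExtAcyclic.of_injective)
  have h2 : IsIso (DerivedCategory.Plus.Qh.map ((HomotopyCategory.Plus.quotient _).map j)) := by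
    refine (isIso_iff_of_reflects_iso _ DerivedCategory.Plus.ι).1 ?_
    exact (isIso_Qh_map_iff j.hom).2 hj'
  have h3 := (rHomUnit R S ω).naturality ((HomotopyCategory.Plus.quotient _).map j)
  have h4 : IsIso ((rHomUnit R S ω).app ((HomotopyCategory.Plus.quotient _).obj K) ≫
      (DerivedCategory.Plus.Qh ⋙ rHom R S ω).map ((HomotopyCategory.Plus.quotient _).map j)) := by
    rw [← h3]
    infer_instance
  have : IsIso ((DerivedCategory.Plus.Qh ⋙ rHom R S ω).map
    ((HomotopyCategory.Plus.quotient _).map j)) := inferInstanceAs (IsIso ((rHom R S ω).map _))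
  exact (isIso_comp_right_iff _ ((DerivedCategory.Plus.Qh ⋙ rHom R S ω).map
    ((HomotopyCategory.Plus.quotient _).map j))).1 h4

/-- Composed with the invertible unit, `derivedEval` becomes the counit `ω ⊗ᴸ N → ω ⊗ N` for `N =
Hom_R(ω, K)`, followed by termwise evaluation, which is invertible by assumption. -/
lemma isIso_derivedEval_iff (K : CochainComplex.Plus (ModuleCat.{u} R))
    (h : ∀ i, ExtAcyclic (ModuleCat.of R ω) (K.obj.X i))
    (h' : ∀ i, IsIso ((evalNat R S ω).app (K.obj.X i))) :
    IsIso ((derivedEval R S ω).app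
      (DerivedCategory.Plus.Qh.obj ((HomotopyCategory.Plus.quotient _).obj K))) ↔
    tensorAcyclic R S ω ((HomotopyCategory.quotient _ _).obj ((cHom R S ω).obj K.obj)) := by
  have hu := isIso_rHomUnit (S := S) K h
  have : IsIso ((lTensorRHomUnit R S ω).app ((HomotopyCategory.Plus.quotient _).obj K)) :=
    inferInstanceAs (IsIso ((DerivedCategory.Plus.ι ⋙ lTensor R S ω).map
      ((rHomUnit R S ω).app ((HomotopyCategory.Plus.quotient _).obj K))))
  have fac := (lTensorRHom R S ω).rightDerived_fac_app (lTensorRHomUnit R S ω)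
    (HomotopyCategory.Plus.quasiIso (ModuleCat.{u} R)) DerivedCategory.Plus.ι (evalPlus R S ω)
    ((HomotopyCategory.Plus.quotient _).obj K)
  rw [← isIso_comp_left_iff ((lTensorRHomUnit R S ω).app _)]
  refine (Iff.of_eq (congrArg (fun φ => IsIso φ) fac)).trans ?_
  have he : IsIso ((NatTrans.mapHomologicalComplex (evalNat R S ω) (ComplexShape.up ℤ)).app
      K.obj) := by
    have (i : ℤ) : IsIso (((NatTrans.mapHomologicalComplex (evalNat R S ω)
      (ComplexShape.up ℤ)).app K.obj).f i) := h' i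
    exact HomologicalComplex.Hom.isIso_of_components _
  have : IsIso (DerivedCategory.Qh.map ((evalHomotopy R S ω).app
      ((HomotopyCategory.quotient _ _).obj K.obj))) :=
    inferInstanceAs (IsIso (DerivedCategory.Qh.map ((HomotopyCategory.quotient _ _).map
      ((NatTrans.mapHomologicalComplex (evalNat R S ω) (ComplexShape.up ℤ)).app K.obj))))
  exact isIso_comp_right_iff _ (DerivedCategory.Qh.map ((evalHomotopy R S ω).app
      ((HomotopyCategory.quotient _ _).obj K.obj)))

/-- A criterion for membership in the Bass class of complexes. -/
lemma isBassComplex_iff (K : CochainComplex.Plus (ModuleCat.{u} R))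
    (h : ∀ i, ExtAcyclic (ModuleCat.of R ω) (K.obj.X i))
    (h' : ∀ i, IsIso ((evalNat R S ω).app (K.obj.X i)))
    (M : Db R) (e : DerivedCategory.Q.obj K.obj ≅ M.obj) :
    IsBassComplex R S ω M ↔
      (DerivedCategory.TStructure.t (C := ModuleCat.{u} S)).bounded
        (DerivedCategory.Q.obj ((cHom R S ω).obj K.obj)) ∧
      tensorAcyclic R S ω ((HomotopyCategory.quotient _ _).obj ((cHom R S ω).obj K.obj)) := by
  have hu := isIso_rHomUnit (S := S) K h
  let X := (HomotopyCategory.Plus.quotient _).obj K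
  let e' : DerivedCategory.Plus.Qh.obj X ≅ (Db.toPlus R).obj M :=
    DerivedCategory.Plus.ι.preimageIso ((DerivedCategory.quotientCompQhIso _).app K.obj ≪≫ e)
  let e'' : ((rHom R S ω).obj ((Db.toPlus R).obj M)).obj ≅
      DerivedCategory.Q.obj ((cHom R S ω).obj K.obj) :=
    DerivedCategory.Plus.ι.mapIso ((rHom R S ω).mapIso e'.symm ≪≫
      (asIso ((rHomUnit R S ω).app X)).symm) ≪≫
        (DerivedCategory.quotientCompQhIso _).app ((cHom R S ω).obj K.obj)
  rw [← isIso_derivedEval_iff K h h', NatTrans.isIso_app_iff_of_iso (derivedEval R S ω) e',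
    ← ((DerivedCategory.TStructure.t (C := ModuleCat.{u} S)).bounded).prop_iff_of_iso e'']
  exact ⟨fun ⟨h₁, h₂⟩ => ⟨h₁, h₂⟩, fun ⟨h₁, h₂⟩ => ⟨h₁, h₂⟩⟩

/-- For an object of the Bass class the supremum is at most any upper bound for the cohomological
degrees of `RHom_R(ω, M)`; the zero object, with value `⊥`, is covered by the same bound. -/
lemma bassInjDim_lt_top_iff (M : Db R) : bassInjDim R S ω M < ⊤ ↔ IsBassComplex R S ω M := by
  unfold bassInjDim
  split_ifs with hM
  · refine iff_of_true ?_ hM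
    obtain ⟨-, b, hb⟩ := hM.bounded
    refine lt_of_le_of_lt (b := ((b : WithTop ℤ) : WithBot (WithTop ℤ))) (sSup_le ?_) ?_
    · rintro _ ⟨n, hn, rfl⟩
      by_contra! hlt
      have : b < n := by exact_mod_cast hlt
      exact hn (DerivedCategory.isZero_of_isLE _ b n this)
    · exact WithBot.coe_lt_coe.2 (WithTop.coe_lt_top b)
  · exact iff_of_false (lt_irrefl _) hM

end BassComplex

/-! ### Tensoring the lowest cocycles of a right resolution. -/

section TensorCocycles
open Limits

variable {R S : Type u} [Ring R] [Ring S]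

/-- The morphism from a module in degree zero given by a map to the cocycles. -/
noncomputable def fromSingleZero {L : CochainComplex (ModuleCat.{u} S) ℤ} {C : ModuleCat.{u} S}
    (c : C ⟶ L.X 0) (h : c ≫ L.d 0 1 = 0) : (CochainComplex.singleFunctor _ 0).obj C ⟶ L :=
  HomologicalComplex.mkHomFromSingle c (by rintro _ rfl; exact h)

lemma fromSingleZero_f {L : CochainComplex (ModuleCat.{u} S) ℤ} {C : ModuleCat.{u} S}
    (c : C ⟶ L.X 0) (h : c ≫ L.d 0 1 = 0) :
    (singleXIso C 0).hom ≫ (fromSingleZero c h).f 0 = c := by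
  have : (fromSingleZero c h).f 0 = (singleXIso C 0).inv ≫ c :=
    HomologicalComplex.mkHomFromSingle_f ..
  rw [this, Iso.hom_inv_id_assoc]

lemma exactAt_of_isZero (L : CochainComplex (ModuleCat.{u} S) ℤ) (i : ℤ) (h : IsZero (L.X i)) :
    L.ExactAt i :=
  ShortComplex.exact_of_isZero_X₂ _ h

/-- A criterion for quasi-isomorphisms from a complex concentrated in degree zero. -/
lemma quasiIsoAt_zero_iff {K L : CochainComplex (ModuleCat.{u} S) ℤ} (f : K ⟶ L)
    (h₁ : IsZero (K.X 1)) (h₂ : IsZero (K.X (-1))) (h₃ : IsZero (L.X (-1))) :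
    QuasiIsoAt f 0 ↔ Function.Exact (f.f 0) (L.d 0 1) ∧ Function.Injective (f.f 0) := by
  rw [quasiIsoAt_iff' f (-1) 0 1 (by simp) (by simp),
    ShortComplex.quasiIso_iff_of_zeros _ (h₂.eq_of_src _ _) (h₁.eq_of_tgt _ _) (h₃.eq_of_src _ _)]
  exact and_congr (ShortComplex.ShortExact.moduleCat_exact_iff_function_exact _)
    (ModuleCat.mono_iff_injective _)

variable {ω : Type u} [AddCommGroup ω] [Module R ω] [Module Sᵐᵒᵖ ω] [SMulCommClass R Sᵐᵒᵖ ω]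
variable [HasDerivedCategory.{w} (ModuleCat.{u} R)] [HasDerivedCategory.{w'} (ModuleCat.{u} S)]

/-- Here `L` is a right resolution of `C`. A projective resolution `P` of `C` and `L` itself both
compute `ω ⊗ᴸ C`, with `ω ⊗ P` in degrees `≤ 0` and `ω ⊗ L` in degrees `≥ 0`. Hence the cohomology
is concentrated in degree zero, where it is both `ω ⊗ C` and the kernel of `ω ⊗ L⁰ → ω ⊗ L¹`. -/
lemma torAcyclic_cocycles_zero (L : CochainComplex (ModuleCat.{u} S) ℤ) [L.IsStrictlyGE 0]
    (hL : ∀ i, 0 < i → L.ExactAt i)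
    (hT : tensorAcyclic R S ω ((HomotopyCategory.quotient _ _).obj L))
    {C : ModuleCat.{u} S} (c : C ⟶ L.X 0) (hc : Function.Injective c)
    (hc' : Function.Exact c (L.d 0 1)) :
    TorAcyclic R S ω C ∧
      Function.Exact ((tensorFunctor R S ω).map c) ((tensorFunctor R S ω).map (L.d 0 1)) ∧
      Function.Injective ((tensorFunctor R S ω).map c) := by
  let f := fromSingleZero c (by ext x; exact (hc' _).2 ⟨x, rfl⟩)
  have hf : (singleXIso C 0).hom ≫ f.f 0 = c := fromSingleZero_f _ _
  have hb := ConcreteCategory.bijective_of_isIso (singleXIso C 0).hom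
  have hfq : QuasiIso f := by
    refine ⟨fun i => ?_⟩
    by_cases hi : i = 0
    · subst hi
      rw [quasiIsoAt_zero_iff _ (isZero_single_X C 0 1 (by lia))
        (isZero_single_X C 0 (-1) (by lia)) (L.isZero_of_isStrictlyGE 0 _ (by lia))]
      have h1 : ⇑(f.f 0) ∘ ⇑(singleXIso C 0).hom = c :=
        funext fun x => ConcreteCategory.congr_hom hf x
      constructor
      · intro x
        rw [hc' x, ← h1, hb.2.range_comp]
      · exact (Function.Injective.of_comp_iff' _ hb).1 (h1 ▸ hc)
    · rw [quasiIsoAt_iff_exactAt]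
      · rcases lt_or_gt_of_ne hi with hi | hi
        · exact exactAt_of_isZero _ _ (L.isZero_of_isStrictlyGE 0 _ hi)
        · exact hL i hi
      · exact exactAt_of_isZero _ _ (isZero_single_X C 0 i hi)
  let P := projectiveResolution C
  have h := (tensorAcyclic_iff_quasiIso (P.π' ≫ f) (tensorAcyclic_resolution P)).1 hT
  have hz (i : ℤ) (hi : i < 0) : IsZero (((cTensor R S ω).obj L).X i) :=
    (tensorFunctor R S ω).map_isZero (L.isZero_of_isStrictlyGE 0 _ hi)
  have hC : TorAcyclic R S ω C := by
    intro n hn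
    obtain ⟨n, rfl⟩ : ∃ m, n = m + 1 := ⟨n - 1, by lia⟩
    rw [isZero_leftDerived_iff P]
    exact (quasiIsoAt_iff_exactAt' ((cTensor R S ω).map (P.π' ≫ f)) _
      (exactAt_of_isZero _ _ (hz _ (by lia)))).1 inferInstance
  have h0 := quasiIso_cTensor_resolution P hC
  rw [Functor.map_comp] at h
  -- Since the higher `Tor` of `C` vanishes, `ω ⊗ P → ω ⊗ C` is a quasi-isomorphism and can be
  -- cancelled from the composite.
  have h1 : QuasiIso ((cTensor R S ω).map f) :=
    quasiIso_of_comp_left ((cTensor R S ω).map P.π') _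
  have h2 := (quasiIsoAt_zero_iff ((cTensor R S ω).map f)
    ((tensorFunctor R S ω).map_isZero (isZero_single_X C 0 1 (by lia)))
    ((tensorFunctor R S ω).map_isZero (isZero_single_X C 0 (-1) (by lia)))
    (hz _ (by lia))).1 inferInstance
  have hb' := ConcreteCategory.bijective_of_isIso ((tensorFunctor R S ω).map (singleXIso C 0).hom)
  have h3 : ⇑((tensorFunctor R S ω).map c) = ⇑((tensorFunctor R S ω).map (f.f 0)) ∘
      ⇑((tensorFunctor R S ω).map (singleXIso C 0).hom) := by
    rw [← hf, Functor.map_comp]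
    rfl
  refine ⟨hC, fun x => ?_, ?_⟩
  · rw [h3, hb'.2.range_comp]
    exact h2.1 x
  · rw [h3]
    exact h2.2.comp hb'.1

/-- If `L` is a complex in degrees `≥ n` which is exact above degree `n` and computes the
derived tensor product, then the cocycles of degree `n` have no higher `Tor`, and are preserved
by the tensor product. -/
lemma torAcyclic_cocycles (L : CochainComplex (ModuleCat.{u} S) ℤ) (n m : ℤ) (hm : n + 1 = m)
    [L.IsStrictlyGE n] (hL : ∀ i, n < i → L.ExactAt i)
    (hT : tensorAcyclic R S ω ((HomotopyCategory.quotient _ _).obj L))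
    {C : ModuleCat.{u} S} (c : C ⟶ L.X n) (hc : Function.Injective c)
    (hc' : Function.Exact c (L.d n m)) :
    TorAcyclic R S ω C ∧
      Function.Exact ((tensorFunctor R S ω).map c) ((tensorFunctor R S ω).map (L.d n m)) ∧
      Function.Injective ((tensorFunctor R S ω).map c) := by
  -- Shift to degree zero. Writing the degrees as `0 + p` and `1 + p` makes the terms of the shifted
  -- complex definitionally those of `L`.
  obtain ⟨p, hp⟩ : ∃ p, p = n := ⟨_, rfl⟩
  obtain rfl : 0 + p = n := by lia
  obtain rfl : 1 + p = m := by lia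
  have hGE : (L⟦p⟧).IsStrictlyGE 0 := L.isStrictlyGE_shift (0 + p) p 0 (by lia)
  have hT' : tensorAcyclic R S ω ((HomotopyCategory.quotient _ _).obj (L⟦p⟧)) :=
    ((tensorAcyclic R S ω).prop_iff_of_iso
      (((HomotopyCategory.quotient _ _).commShiftIso p).app L)).2
        ((tensorAcyclic_shift_iff _ p).2 hT)
  have hLE : L.IsLE (0 + p) := (CochainComplex.isLE_iff _ _).2 hL
  have hLE' : (L⟦p⟧).IsLE 0 := L.isLE_shift (0 + p) p 0 (by lia)
  have hd : (L⟦p⟧).d 0 1 = p.negOnePow • L.d (0 + p) (1 + p) := rfl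
  have hd' : (tensorFunctor R S ω).map ((L⟦p⟧).d 0 1) =
      p.negOnePow • (tensorFunctor R S ω).map (L.d (0 + p) (1 + p)) := by
    rw [hd]
    exact (tensorFunctor R S ω).map_units_smul ..
  -- The shift alters the differential only by a sign, which does not change its kernel.
  have hs {T : Type u} [Ring T] {A B : ModuleCat.{u} T} (g : A ⟶ B) (x : A) :
      (p.negOnePow • g) x = 0 ↔ g x = 0 := by
    obtain h | h := Int.units_eq_one_or p.negOnePow <;> simp [h]
  have h := torAcyclic_cocycles_zero (L⟦p⟧) (fun i hi => (L⟦p⟧).exactAt_of_isLE 0 i hi) hT' c hc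
    (fun x => (hs (L.d (0 + p) (1 + p)) x).trans (hc' x))
  refine ⟨h.1, fun x => Iff.trans ?_ (h.2.1 x), h.2.2⟩
  rw [hd']
  exact (hs ((tensorFunctor R S ω).map (L.d (0 + p) (1 + p))) x).symm

end TensorCocycles

/-! ### The high cocycles are Bass modules; the two implications. -/

section Main
open Limits

variable {R S : Type u} [Ring R] [Ring S]
variable {ω : Type u} [AddCommGroup ω] [Module R ω] [Module Sᵐᵒᵖ ω] [SMulCommClass R Sᵐᵒᵖ ω]

lemma IsBass.of_iso {M M' : ModuleCat.{u} R} (h : IsBass R S ω M) (e : M ≅ M') :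
    IsBass R S ω M' where
  ext := ExtAcyclic.of_iso h.ext e
  tor := TorAcyclic.of_iso h.tor ((homFunctor R S ω).mapIso e)
  static := (NatTrans.isIso_app_iff_of_iso (evalNat R S ω) e).1 h.static

lemma IsBass.of_isZero {M : ModuleCat.{u} R} (h : IsZero M) : IsBass R S ω M where
  ext := ExtAcyclic.of_isZero h
  tor := TorAcyclic.of_isZero ((homFunctor R S ω).map_isZero h)
  static :=
    ((tensorFunctor R S ω).map_isZero ((homFunctor R S ω).map_isZero h)).isIso h _

lemma homFunctor_map_injective {M M' : ModuleCat.{u} R} (f : M ⟶ M') (hf : Function.Injective f) :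
    Function.Injective ((homFunctor R S ω).map f) := fun _ _ h =>
  LinearMap.ext fun x => hf (LinearMap.congr_fun h x)

lemma homFunctor_map_cycι_exact (K : CochainComplex (ModuleCat.{u} R) ℤ) (n : ℤ) :
    Function.Exact ((homFunctor R S ω).map (cycι K n))
      ((homFunctor R S ω).map (K.d n (n + 1))) := by
  intro x
  constructor
  · intro h
    exact ⟨LinearMap.codRestrict _ x fun y => LinearMap.congr_fun h y, rfl⟩
  · rintro ⟨y, rfl⟩
    exact LinearMap.ext fun z => (HomMod.toLin ω y z).2

/-- The evaluation map is bijective on a kernel preserved by `ω ⊗_S Hom_R(ω, -)`. -/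
lemma isIso_evalNat_of_exact {Z E E' : ModuleCat.{u} R} (f : Z ⟶ E) (g : E ⟶ E')
    (hf : Function.Injective f) (hfg : Function.Exact f g) [hE : IsIso ((evalNat R S ω).app E)]
    [hE' : IsIso ((evalNat R S ω).app E')]
    (hi : Function.Injective ((tensorFunctor R S ω).map ((homFunctor R S ω).map f)))
    (he : Function.Exact ((tensorFunctor R S ω).map ((homFunctor R S ω).map f))
      ((tensorFunctor R S ω).map ((homFunctor R S ω).map g))) :
    IsIso ((evalNat R S ω).app Z) := by
  have hb := ConcreteCategory.bijective_of_isIso ((evalNat R S ω).app E)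
  have hb' := ConcreteCategory.bijective_of_isIso ((evalNat R S ω).app E')
  have nf (x) : (evalNat R S ω).app E ((tensorFunctor R S ω).map ((homFunctor R S ω).map f) x) =
      f ((evalNat R S ω).app Z x) :=
    ConcreteCategory.congr_hom ((evalNat R S ω).naturality f) x
  have ng (x) : (evalNat R S ω).app E' ((tensorFunctor R S ω).map ((homFunctor R S ω).map g) x) =
      g ((evalNat R S ω).app E x) :=
    ConcreteCategory.congr_hom ((evalNat R S ω).naturality g) x
  rw [ConcreteCategory.isIso_iff_bijective]
  constructor
  · intro x y h
    exact hi (hb.1 (by rw [nf, nf, h]))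
  · intro z
    obtain ⟨y, hy⟩ := hb.2 (f z)
    have h0 : (tensorFunctor R S ω).map ((homFunctor R S ω).map g) y = 0 := hb'.1 (by
      rw [ng, hy, map_zero]
      exact (hfg _).2 ⟨z, rfl⟩)
    obtain ⟨x, rfl⟩ := (he y).1 h0
    exact ⟨x, hf (by rw [← nf, hy])⟩

/-- The cocycles as a term of the canonical truncation. -/
lemma nonempty_truncLE_X_iso_cyc (K : CochainComplex (ModuleCat.{u} R) ℤ) (n : ℤ) :
    Nonempty ((K.truncLE n).X n ≅ cyc K n) :=
  ⟨K.truncLEXIsoCycles n ≪≫ K.cyclesIsoSc' (n - 1) n (n + 1) (by simp) (by simp) ≪≫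
    (K.sc' (n - 1) n (n + 1)).moduleCatCyclesIso⟩

lemma brutalGE_exactAt {N : CochainComplex (ModuleCat.{u} S) ℤ} (n : ℤ)
    (hN : ∀ i, n < i → N.ExactAt i) (i : ℤ) (hi : n < i) : (brutalGE N n).ExactAt i := by
  obtain ⟨i, rfl⟩ : ∃ j, i = j + 1 := ⟨i - 1, by lia⟩
  have h := hN _ hi
  rw [HomologicalComplex.exactAt_iff' _ i (i + 1) (i + 1 + 1) (by simp) (by simp),
    ShortComplex.moduleCat_exact_iff] at h ⊢
  intro x hx
  obtain ⟨y, hy⟩ := h x.1 (congrArg Subtype.val hx)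
  exact ⟨⟨y, fun hi' => absurd hi' (by lia)⟩, Subtype.ext hy⟩

variable [HasDerivedCategory.{w} (ModuleCat.{u} R)] [HasDerivedCategory.{w'} (ModuleCat.{u} S)]

/-- High cocycles of a complex of Bass modules which lies in the Bass class. -/
lemma isBass_cyc (I : CochainComplex (ModuleCat.{u} R) ℤ) (a n : ℤ) [I.IsStrictlyGE a]
    (hI : ∀ i, IsBass R S ω (I.X i)) (h₁ : ∀ i, n < i → I.ExactAt i)
    (h₂ : ∀ i, n < i → ((cHom R S ω).obj I).ExactAt i)
    (h₃ : tensorAcyclic R S ω ((HomotopyCategory.quotient _ _).obj ((cHom R S ω).obj I))) :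
    IsBass R S ω (cyc I n) := by
  let N := (cHom R S ω).obj I
  have hLT (i : ℤ) (hi : i < n) : (brutalLT N n).X i ≅ N.X i := by
    have := isIso_brutalπ_f N i hi
    exact (asIso ((brutalπ N n).f i)).symm
  have : (brutalLT N n).IsStrictlyGE a := by
    refine (CochainComplex.isStrictlyGE_iff _ _).2 fun i hi => ?_
    by_cases hi' : i < n
    · exact ((homFunctor R S ω).map_isZero (I.isZero_of_isStrictlyGE a i hi)).of_iso (hLT i hi')
    · exact isZero_brutalLT_X N i (by lia)
  have : (brutalLT N n).IsStrictlyLE n := (CochainComplex.isStrictlyLE_iff _ _).2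
    fun i hi => isZero_brutalLT_X N i (by lia)
  -- The part of `N` in degrees `< n` is bounded, with terms without higher `Tor`, so discarding it
  -- preserves being `tensorAcyclic`.
  have hT := (tensorAcyclic_brutal N n (tensorAcyclic_of_bounded (R := R) (ω := ω) (brutalLT N n)
    (fun i => by
      by_cases hi : i < n
      · exact TorAcyclic.of_iso (hI i).tor (hLT i hi).symm
      · exact TorAcyclic.of_isZero (isZero_brutalLT_X N i (by lia))) a n)).2 h₃
  have := isIso_brutalι_f N n le_rfl
  have := isIso_brutalι_f N (n := n) (n + 1) (by lia)
  let ι : (homFunctor R S ω).obj (cyc I n) ⟶ N.X n := (homFunctor R S ω).map (cycι I n)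
  -- By left exactness of `Hom_R(ω, -)`, this identifies `Hom_R(ω, Zⁿ)` with the cocycles of degree
  -- `n` of the truncated complex.
  let c : (homFunctor R S ω).obj (cyc I n) ⟶ (brutalGE N n).X n := ι ≫ inv ((brutalι N n).f n)
  have hc : c ≫ (brutalι N n).f n = ι := by simp [c]
  have hi := homFunctor_map_injective (S := S) (ω := ω) (cycι I n) (cycι_injective I n)
  have he := homFunctor_map_cycι_exact (S := S) (ω := ω) I n
  have hb := ConcreteCategory.bijective_of_isIso ((brutalι N n).f n)
  have hb' := ConcreteCategory.bijective_of_isIso ((brutalι N n).f (n + 1))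
  have hcx (x) : (brutalι N n).f n (c x) = ι x :=
    ConcreteCategory.congr_hom hc x
  obtain ⟨k₁, k₂, k₃⟩ := torAcyclic_cocycles (brutalGE N n) n (n + 1) rfl
    (brutalGE_exactAt n h₂) hT c (fun x y h => hi ((hcx x).symm.trans ((congrArg _ h).trans (hcx y))))
    (fun x => by
      rw [← map_eq_zero_iff _ hb'.1, comm_apply]
      refine (he _).trans ⟨?_, ?_⟩
      · rintro ⟨y, hy⟩
        exact ⟨y, hb.1 ((hcx y).trans hy)⟩
      · rintro ⟨y, rfl⟩
        exact ⟨y, (hcx y).symm⟩)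
  have hT₀ := ConcreteCategory.bijective_of_isIso
    ((tensorFunctor R S ω).map ((brutalι N n).f n))
  have hT₁ := ConcreteCategory.bijective_of_isIso
    ((tensorFunctor R S ω).map ((brutalι N n).f (n + 1)))
  have hTc (x) : (tensorFunctor R S ω).map ((brutalι N n).f n) ((tensorFunctor R S ω).map c x) =
      (tensorFunctor R S ω).map ι x :=
    ConcreteCategory.congr_hom (((tensorFunctor R S ω).map_comp c ((brutalι N n).f n)).symm.trans
      (congrArg (tensorFunctor R S ω).map hc)) x
  have hTd (x) : (tensorFunctor R S ω).map ((brutalι N n).f (n + 1))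
      ((tensorFunctor R S ω).map ((brutalGE N n).d n (n + 1)) x) =
      (tensorFunctor R S ω).map (N.d n (n + 1))
        ((tensorFunctor R S ω).map ((brutalι N n).f n) x) :=
    comm_apply ((cTensor R S ω).map (brutalι N n)) n (n + 1) x
  have := (hI n).static
  have := (hI (n + 1)).static
  refine ⟨extAcyclic_cyc_of_lift n (fun i hi => h₁ _ (by lia)) (fun i => (hI i).ext)
    (fun i hi => (exactAt_cHom_iff i).1 (h₂ _ (by lia))) n le_rfl, k₁,
    isIso_evalNat_of_exact (cycι I n) (I.d n (n + 1)) (cycι_injective I n) (fun x => ?_)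
      (fun x y h => k₃ (hT₀.1 ((hTc x).trans (h.trans (hTc y).symm)))) (fun x => ?_)⟩
  · exact ⟨fun h => ⟨⟨x, h⟩, rfl⟩, fun ⟨y, hy⟩ => hy ▸ y.2⟩
  · obtain ⟨x, rfl⟩ := hT₀.2 x
    refine (Iff.of_eq (congrArg (· = 0) (hTd x).symm)).trans
      ((map_eq_zero_iff _ hT₁.1).trans ((k₂ x).trans ⟨?_, ?_⟩))
    · rintro ⟨y, rfl⟩
      exact ⟨y, (hTc y).symm⟩
    · rintro ⟨y, hy⟩
      exact ⟨y, hT₀.1 ((hTc y).trans hy)⟩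

/-- An injective resolution is replaced by its canonical truncation, far enough up that the cocycles
ending it form a Bass module. -/
theorem exists_bass_resolution (hω : IsSemidualizing R S ω) (M : Db R)
    (hM : IsBassComplex R S ω M) :
    ∃ (Y : CochainComplex (ModuleCat.{u} R) ℤ) (a b : ℤ) (ha : Y.IsStrictlyGE a)
      (hb : Y.IsStrictlyLE b), (∀ n : ℤ, IsBass R S ω (Y.X n)) ∧
        Nonempty (M ≅ Db.ofComplex Y a b ha hb) := by
  obtain ⟨a, ha⟩ := M.property.1
  obtain ⟨b, hb⟩ := M.property.2
  have : ((Db.toPlus R).obj M).IsGE a := (DerivedCategory.Plus.isGE_ι_obj_iff _ a).1 ha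
  obtain ⟨L, hL, ⟨e⟩⟩ :=
    DerivedCategory.Plus.exists_injective_nonempty_iso ((Db.toPlus R).obj M) a
  let J := (InjectiveObject.ι (ModuleCat.{u} R)).mapCochainComplexPlus.obj L
  have : J.obj.IsStrictlyGE a :=
    (CochainComplex.isStrictlyGE_mapHomologicalComplex_obj_iff _ (InjectiveObject.ι _) a).2 hL
  have (i : ℤ) : Injective (J.obj.X i) :=
    inferInstanceAs (Injective ((InjectiveObject.ι _).obj (L.obj.X i)))
  have hJ (i : ℤ) : IsBass R S ω (J.obj.X i) := isBass_of_injective hω _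
  let e₀ : DerivedCategory.Q.obj J.obj ≅ M.obj :=
    ((DerivedCategory.quotientCompQhIso _).app J.obj).symm ≪≫ DerivedCategory.Plus.ι.mapIso e
  obtain ⟨⟨-, b', hb'⟩, hT⟩ :=
    (isBassComplex_iff J (fun i => (hJ i).ext) (fun i => (hJ i).static) M e₀).1 hM
  have hb₁ : J.obj.IsLE b := by
    rw [← DerivedCategory.isLE_Q_obj_iff]
    exact (DerivedCategory.TStructure.t.isLE_of_iso e₀.symm b : _)
  have hb₂ : ((cHom R S ω).obj J.obj).IsLE b' := (DerivedCategory.isLE_Q_obj_iff _ _).1 hb'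
  -- Beyond `b` the resolution is exact, and beyond `b'` so is `Hom_R(ω, -)` of it; `isBass_cyc`
  -- needs both.
  obtain ⟨n, hn⟩ : ∃ n, n = max b b' := ⟨_, rfl⟩
  have hc := isBass_cyc J.obj a n hJ (fun i hi => J.obj.exactAt_of_isLE b i)
    (fun i hi => ((cHom R S ω).obj J.obj).exactAt_of_isLE b' i) hT
  have : J.obj.IsLE n := J.obj.isLE_of_le b n (by lia)
  have hY : (J.obj.truncLE n).IsStrictlyGE a := inferInstance
  refine ⟨J.obj.truncLE n, a, n, inferInstance, inferInstance, fun i => ?_, ⟨?_⟩⟩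
  · rcases lt_trichotomy i n with hi | rfl | hi
    · exact (hJ i).of_iso (J.obj.truncLEXIso n i).symm
    · obtain ⟨e⟩ := nonempty_truncLE_X_iso_cyc J.obj i
      exact hc.of_iso e.symm
    · exact IsBass.of_isZero (CochainComplex.isZero_of_isStrictlyLE _ n i)
  · exact ObjectProperty.isoMk _
      (e₀.symm ≪≫ (asIso (DerivedCategory.Q.map (J.obj.ιTruncLE n))).symm)

/-- The complex `Y` can itself be used to test membership: `Hom_R(ω, Y)` is bounded, and its terms
have no higher `Tor`. -/
theorem isBassComplex_of_iso {M : Db R} {Y : CochainComplex (ModuleCat.{u} R) ℤ} {a b : ℤ}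
    {ha : Y.IsStrictlyGE a} {hb : Y.IsStrictlyLE b} (hY : ∀ n : ℤ, IsBass R S ω (Y.X n))
    (e : M ≅ Db.ofComplex Y a b ha hb) : IsBassComplex R S ω M := by
  have h₁ : ((cHom R S ω).obj Y).IsStrictlyGE a := (CochainComplex.isStrictlyGE_iff _ _).2
    fun i hi => (homFunctor R S ω).map_isZero (Y.isZero_of_isStrictlyGE a i hi)
  have h₂ : ((cHom R S ω).obj Y).IsStrictlyLE b := (CochainComplex.isStrictlyLE_iff _ _).2
    fun i hi => (homFunctor R S ω).map_isZero (Y.isZero_of_isStrictlyLE b i hi)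
  exact (isBassComplex_iff ⟨Y, a, ha⟩ (fun i => (hY i).ext) (fun i => (hY i).static) M
    ((ObjectProperty.ι _).mapIso e.symm)).2 ⟨(Db.ofComplex _ a b h₁ h₂).property,
      tensorAcyclic_of_bounded _ (fun i => (hY i).tor) a b⟩

end Main

end BassClass

theorem theorem5p5 {R S : Type u} [Ring R] [Ring S]
    {ω : Type u} [AddCommGroup ω] [Module R ω] [Module Sᵐᵒᵖ ω] [SMulCommClass R Sᵐᵒᵖ ω]
    [HasDerivedCategory.{w} (ModuleCat.{u} R)] [HasDerivedCategory.{w'} (ModuleCat.{u} S)]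
    (hω : BassClass.IsSemidualizing R S ω) (M : BassClass.Db R) :
    BassClass.bassInjDim R S ω M < ⊤ ↔
      ∃ (Y : CochainComplex (ModuleCat.{u} R) ℤ) (a b : ℤ)
        (ha : Y.IsStrictlyGE a) (hb : Y.IsStrictlyLE b),
        (∀ n : ℤ, BassClass.IsBass R S ω (Y.X n)) ∧
          Nonempty (M ≅ BassClass.Db.ofComplex Y a b ha hb) := by
  rw [BassClass.bassInjDim_lt_top_iff]
  refine ⟨BassClass.exists_bass_resolution hω M, ?_⟩
  rintro ⟨Y, a, b, ha, hb, hY, ⟨e⟩⟩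
  exact BassClass.isBassComplex_of_iso hY e
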